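/- Let $p$ be a prime, and let $E/\mathbb{Q}_p$ be an elliptic curve given by a Weierstrass equation over $\mathbb{Z}_p$ $$Y^2 + a_1 XY + a_3 Y = X^3 + a_2 X^2 + a_4 X + a_6$$ with $a_i \in p\mathbb{Z}_p$ for each $i \in \{1,2,3,4,6\}$. Let $E_0(\mathbb{Q}_p) \subset E(\mathbb{Q}_p)$ be the subgroup of points that reduce to a nonsingular point of the reduced curve over $\mathbb{F}_p$. Give $E_0(\mathbb{Q}_p)$ the topology induced from $\mathbb{P}^2(\mathbb{Q}_p)$. Then the group $E_0(\mathbb{Q}_p)$ has exactly one $\mathbb{Z}_p$-module structure for which scalar multiplication $\mathbb{Z}_p \times E_0(\mathbb{Q}_p) \to E_0(\mathbb{Q}_p)$ is continuous. Consider the following four special cases: (i) $p=2$ and $a_1+a_3 \equiv 2 \pmod 4$; (ii) $p=3$ and $a_2 \equiv 6 \pmod 9$; (iii) $p=5$ and $a_4 \equiv 10 \pmod{25}$; (iv) $p=7$ and $a_6 \equiv 14 \pmod{49}$. If none of (i)-(iv) holds, then $E_0(\mathbb{Q}_p) \cong \mathbb{Z}_p$ as $\mathbb{Z}_p$-modules.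 If one of (i)-(iv) holds, then $E_0(\mathbb{Q}_p) \cong \mathbb{Z}_p \times \mathbb{Z}/p\mathbb{Z}$ as $\mathbb{Z}_p$-modules. -/

import Mathlib

open scoped LinearAlgebra.Projectivization

namespace AdditiveReduction

/-! ### The standard topology on the points of a Weierstrass curve -/

/-- The quotient topology on the projective space of `V`, coming from `V ∖ {0}`. -/
instance projectivizationTopology (K V : Type*) [DivisionRing K] [AddCommGroup V] [Module K V]
    [TopologicalSpace V] : TopologicalSpace (ℙ K V) :=
  TopologicalSpace.coinduced (Projectivization.mk' K) inferInstance

/-- The embedding of the nonsingular points of a Weierstrass curve into the projective plane: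
`(x, y) ↦ (x : y : 1)`, and the point at infinity goes to `(0 : 1 : 0)`. -/
def toPlane {K : Type*} [Field K] (E : WeierstrassCurve.Affine K) : E.Point → ℙ K (Fin 3 → K)
  | .zero => Projectivization.mk K ![0, 1, 0] (fun h => one_ne_zero (congrFun h 1))
  | .some x y _ => Projectivization.mk K ![x, y, 1] (fun h => one_ne_zero (congrFun h 2))

/-- The standard topology on the points, induced from the projective plane. -/
instance pointTopology {K : Type*} [Field K] [TopologicalSpace K]
    (E : WeierstrassCurve.Affine K) : TopologicalSpace E.Point :=
  TopologicalSpace.induced (toPlane E) inferInstance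

section PointsOfGoodReduction

variable {p : ℕ} [Fact p.Prime]

noncomputable instance padicDecidableEq : DecidableEq ℚ_[p] := Classical.decEq _

/-- The curve over `ℚ_p` given by a Weierstrass equation over `ℤ_p`. -/
noncomputable abbrev genericFiber (W : WeierstrassCurve ℤ_[p]) : WeierstrassCurve.Affine ℚ_[p] :=
  (W.map (algebraMap ℤ_[p] ℚ_[p])).toAffine

/-- The reduced curve over the residue field `𝔽_p`. -/
noncomputable abbrev specialFiber (W : WeierstrassCurve ℤ_[p]) : WeierstrassCurve.Affine (ZMod p) :=
  (W.map PadicInt.toZMod).toAffine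

/-- The point reduces to a nonsingular point of the reduced curve. The point at infinity and the
affine points with non-integral coordinates reduce to `(0 : 1 : 0)`, which is always nonsingular;
a point with coordinates in `ℤ_p` reduces to the point with the reduced coordinates. (As `x` is
integral over `ℤ_p[y]` and `y` over `ℤ_p[x]`, either both coordinates are in `ℤ_p` or neither.) -/
def HasNonsingularReduction (W : WeierstrassCurve ℤ_[p]) : (genericFiber W).Point → Prop
  | .zero => True
  | .some x y _ => ∀ x₀ y₀ : ℤ_[p], (x₀ : ℚ_[p]) = x → (y₀ : ℚ_[p]) = y →
      (specialFiber W).Nonsingular (PadicInt.toZMod x₀) (PadicInt.toZMod y₀)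

/-- All Weierstrass coefficients lie in `pℤ_p`. -/
structure CoeffsDivisible (W : WeierstrassCurve ℤ_[p]) : Prop where
  a₁ : (p : ℤ_[p]) ∣ W.a₁
  a₂ : (p : ℤ_[p]) ∣ W.a₂
  a₃ : (p : ℤ_[p]) ∣ W.a₃
  a₄ : (p : ℤ_[p]) ∣ W.a₄
  a₆ : (p : ℤ_[p]) ∣ W.a₆

/-! Helper facts, which show that the points of nonsingular reduction form a subgroup. -/

theorem norm_add_lt {a b : ℚ_[p]} {C : ℝ} (ha : ‖a‖ < C) (hb : ‖b‖ < C) : ‖a + b‖ < C :=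
  (IsUltrametricDist.norm_add_le_max a b).trans_lt (max_lt ha hb)

theorem norm_sub_lt {a b : ℚ_[p]} {C : ℝ} (ha : ‖a‖ < C) (hb : ‖b‖ < C) : ‖a - b‖ < C := by
  rw [sub_eq_add_neg]; exact norm_add_lt ha (by rwa [norm_neg])

theorem norm_coe_lt {a : ℤ_[p]} (h : (p : ℤ_[p]) ∣ a) : ‖(a : ℚ_[p])‖ < 1 := by
  rw [PadicInt.padic_norm_e_of_padicInt]; exact PadicInt.norm_lt_one_iff_dvd a |>.2 h

theorem toZMod_eq_zero_iff {a : ℤ_[p]} : PadicInt.toZMod a = 0 ↔ ‖(a : ℚ_[p])‖ < 1 := by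
  rw [PadicInt.padic_norm_e_of_padicInt, ← RingHom.mem_ker, PadicInt.ker_toZMod,
    PadicInt.maximalIdeal_eq_span_p, Ideal.mem_span_singleton, PadicInt.norm_lt_one_iff_dvd]

theorem equation_coe {W : WeierstrassCurve ℤ_[p]} {x y : ℚ_[p]}
    (h : (genericFiber W).Nonsingular x y) :
    y ^ 2 + W.a₁ * x * y + W.a₃ * y = x ^ 3 + W.a₂ * x ^ 2 + W.a₄ * x + W.a₆ := by
  have := ((genericFiber W).equation_iff x y).1 h.1
  simpa using this

theorem norm_y_lt {W : WeierstrassCurve ℤ_[p]} (hW : CoeffsDivisible W) {x y : ℚ_[p]}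
    (h : (genericFiber W).Nonsingular x y) (hx : ‖x‖ < 1) : ‖y‖ < 1 := by
  by_contra! hy
  have e : y ^ 2 = x * x * x + W.a₂ * x * x + W.a₄ * x + W.a₆ - W.a₁ * x * y - W.a₃ * y := by
    linear_combination equation_coe h
  have h1 := norm_coe_lt hW.a₁
  have h2 := norm_coe_lt hW.a₂
  have h3 := norm_coe_lt hW.a₃
  have h4 := norm_coe_lt hW.a₄
  have h6 := norm_coe_lt hW.a₆
  have hx0 := norm_nonneg x
  have hyy : ‖y‖ ≤ ‖y‖ ^ 2 := by nlinarith
  have hxx : ‖x‖ * ‖x‖ < 1 := by nlinarith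
  have : ‖y ^ 2‖ < ‖y‖ ^ 2 := by
    rw [e]
    refine norm_sub_lt (norm_sub_lt (norm_add_lt (norm_add_lt (norm_add_lt ?_ ?_) ?_) ?_) ?_) ?_
    all_goals try simp only [norm_mul]
    · nlinarith
    · nlinarith [norm_nonneg (W.a₂ : ℚ_[p]), mul_nonneg (norm_nonneg (W.a₂ : ℚ_[p])) hx0]
    · nlinarith [norm_nonneg (W.a₄ : ℚ_[p])]
    · nlinarith
    · have : ‖(W.a₁ : ℚ_[p])‖ * ‖x‖ < 1 := by nlinarith [norm_nonneg (W.a₁ : ℚ_[p])]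
      nlinarith
    · nlinarith
  rw [norm_pow] at this
  exact lt_irrefl _ this

theorem norm_y_sq_le {W : WeierstrassCurve ℤ_[p]} (hW : CoeffsDivisible W) {x y : ℚ_[p]}
    (h : (genericFiber W).Nonsingular x y) (hx : 1 ≤ ‖x‖) : ‖y‖ ^ 2 ≤ ‖x‖ ^ 3 := by
  by_contra! hy
  have e : y ^ 2 = x ^ 3 + W.a₂ * x ^ 2 + W.a₄ * x + W.a₆ - W.a₁ * x * y - W.a₃ * y := by
    linear_combination equation_coe h
  have h1 := norm_coe_lt hW.a₁
  have h2 := norm_coe_lt hW.a₂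
  have h3 := norm_coe_lt hW.a₃
  have h4 := norm_coe_lt hW.a₄
  have h6 := norm_coe_lt hW.a₆
  have p2 : ‖x‖ ≤ ‖x‖ ^ 2 := by nlinarith
  have p3 : ‖x‖ ^ 2 ≤ ‖x‖ ^ 3 := by nlinarith [sq_nonneg ‖x‖]
  have hxy : ‖x‖ < ‖y‖ := lt_of_pow_lt_pow_left₀ 2 (norm_nonneg y) (p3.trans_lt hy)
  have : ‖y ^ 2‖ < ‖y‖ ^ 2 := by
    rw [e]
    refine norm_sub_lt (norm_sub_lt (norm_add_lt (norm_add_lt (norm_add_lt ?_ ?_) ?_) ?_) ?_) ?_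
    all_goals try simp only [norm_mul, norm_pow]
    · exact hy
    · nlinarith [sq_nonneg ‖x‖]
    · nlinarith
    · nlinarith
    · have : ‖(W.a₁ : ℚ_[p])‖ * ‖x‖ < ‖y‖ := by nlinarith
      nlinarith
    · nlinarith
  rw [norm_pow] at this
  exact lt_irrefl _ this

theorem reduction_some_iff {W : WeierstrassCurve ℤ_[p]} (hW : CoeffsDivisible W) {x y : ℚ_[p]}
    (h : (genericFiber W).Nonsingular x y) :
    HasNonsingularReduction W (.some x y h) ↔ 1 ≤ ‖x‖ := by
  have e := equation_coe h
  have z1 := toZMod_eq_zero_iff.2 (norm_coe_lt hW.a₁)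
  have z2 := toZMod_eq_zero_iff.2 (norm_coe_lt hW.a₂)
  have z3 := toZMod_eq_zero_iff.2 (norm_coe_lt hW.a₃)
  have z4 := toZMod_eq_zero_iff.2 (norm_coe_lt hW.a₄)
  have z6 := toZMod_eq_zero_iff.2 (norm_coe_lt hW.a₆)
  constructor
  · intro hP
    by_contra! hx
    have hy := norm_y_lt hW h hx
    have hn := hP ⟨x, hx.le⟩ ⟨y, hy.le⟩ rfl rfl
    rw [(toZMod_eq_zero_iff (a := ⟨x, hx.le⟩)).2 hx, (toZMod_eq_zero_iff (a := ⟨y, hy.le⟩)).2 hy,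
      WeierstrassCurve.Affine.nonsingular_iff] at hn
    simp [z3, z4] at hn
  · rintro hx x₀ y₀ rfl rfl
    have e' : y₀ ^ 2 + W.a₁ * x₀ * y₀ + W.a₃ * y₀
        = x₀ ^ 3 + W.a₂ * x₀ ^ 2 + W.a₄ * x₀ + W.a₆ := by
      apply PadicInt.ext
      simpa using e
    have e₀ := congrArg (PadicInt.toZMod (p := p)) e'
    simp only [map_add, map_mul, map_pow, z1, z2, z3, z4, z6, zero_mul, add_zero] at e₀
    have hx0 : PadicInt.toZMod x₀ ≠ 0 := fun h0 => absurd (toZMod_eq_zero_iff.1 h0) (not_lt.2 hx)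
    have hy0 : PadicInt.toZMod y₀ ≠ 0 := by
      intro h0
      rw [h0] at e₀
      exact hx0 (pow_eq_zero_iff (three_ne_zero) |>.1 (by rw [← e₀]; simp))
    rw [WeierstrassCurve.Affine.nonsingular_iff', WeierstrassCurve.Affine.equation_iff]
    simp only [WeierstrassCurve.map_a₁, WeierstrassCurve.map_a₂, WeierstrassCurve.map_a₃,
      WeierstrassCurve.map_a₄, WeierstrassCurve.map_a₆, z1, z2, z3, z4, z6]
    refine ⟨by simpa using e₀, ?_⟩
    by_contra! hc
    obtain ⟨c1, c2⟩ := hc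
    have t : (3 : ZMod p) = 0 := by
      have : (3 : ZMod p) * PadicInt.toZMod x₀ ^ 2 = 0 := by linear_combination -c1
      exact (mul_eq_zero.1 this).resolve_right (pow_ne_zero 2 hx0)
    have u : (2 : ZMod p) = 0 := by
      have : (2 : ZMod p) * PadicInt.toZMod y₀ = 0 := by linear_combination c2
      exact (mul_eq_zero.1 this).resolve_right hy0
    exact one_ne_zero (α := ZMod p) (by linear_combination t - u)

theorem norm_addX_lt {W : WeierstrassCurve ℤ_[p]} (hW : CoeffsDivisible W) {x₁ y₁ x₂ y₂ : ℚ_[p]}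
    (h₁ : (genericFiber W).Nonsingular x₁ y₁) (h₂ : (genericFiber W).Nonsingular x₂ y₂)
    (hx₁ : 1 ≤ ‖x₁‖) (hx₂ : ‖x₂‖ < 1) :
    ‖(genericFiber W).addX x₁ x₂ ((genericFiber W).slope x₁ x₂ y₁ y₂)‖ < 1 := by
  have hne : x₁ ≠ x₂ := by rintro rfl; exact absurd hx₁ (not_le.2 hx₂)
  have hd : x₁ - x₂ ≠ 0 := sub_ne_zero.2 hne
  rw [WeierstrassCurve.Affine.slope_of_X_ne hne, WeierstrassCurve.Affine.addX]
  simp only [WeierstrassCurve.map_a₁, WeierstrassCurve.map_a₂, PadicInt.algebraMap_apply]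
  set x₃ : ℚ_[p] := ((y₁ - y₂) / (x₁ - x₂)) ^ 2 + W.a₁ * ((y₁ - y₂) / (x₁ - x₂)) - W.a₂ - x₁ - x₂
    with hx₃
  have e₁ := equation_coe h₁
  have e₂ := equation_coe h₂
  have hx₃' : x₃ * (x₁ - x₂) ^ 2 = (y₁ - y₂) ^ 2 + W.a₁ * (y₁ - y₂) * (x₁ - x₂)
      - (W.a₂ + x₁ + x₂) * (x₁ - x₂) ^ 2 := by
    rw [hx₃]; field_simp; ring
  have key : x₃ * (x₁ + x₂) * (x₁ - x₂) ^ 2 =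
      W.a₄ * (x₁ - x₂) ^ 2 - x₁ * x₂ * (x₁ - x₂) ^ 2
      - 2 * ((y₁ - y₂) * (y₂ * x₁ - y₁ * x₂)) - W.a₃ * ((y₁ - y₂) * (x₁ - x₂))
      - W.a₁ * ((y₂ * x₁ - y₁ * x₂) * (x₁ - x₂)) := by
    linear_combination (x₁ + x₂) * hx₃' + (x₁ - x₂) * (e₁ - e₂)
  have hX (z : ℚ_[p]) (hz : ‖z‖ < 1) : ‖x₁ + z‖ = ‖x₁‖ := by
    refine le_antisymm ((IsUltrametricDist.norm_add_le_max _ _).trans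
      (max_le le_rfl (hz.le.trans hx₁))) ?_
    by_contra! hc
    have := norm_sub_lt hc (hz.trans_le hx₁)
    rw [add_sub_cancel_right] at this
    exact lt_irrefl _ this
  have n1 : ‖x₁ + x₂‖ = ‖x₁‖ := hX x₂ hx₂
  have n2 : ‖x₁ - x₂‖ = ‖x₁‖ := by
    rw [sub_eq_add_neg]; exact hX (-x₂) (by rwa [norm_neg])
  have hy₂ := norm_y_lt hW h₂ hx₂
  obtain ⟨M, hM1, hMy, hMX⟩ : ∃ M : ℝ, 1 ≤ M ∧ ‖y₁‖ ≤ M ∧ M ^ 2 ≤ ‖x₁‖ ^ 3 := by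
    refine ⟨max 1 ‖y₁‖, le_max_left _ _, le_max_right _ _, ?_⟩
    rcases max_choice 1 ‖y₁‖ with h | h <;> rw [h]
    · simpa using one_le_pow₀ hx₁
    · exact norm_y_sq_le hW h₁ hx₁
  have hr : ‖y₁ - y₂‖ ≤ M := by
    rw [sub_eq_add_neg]
    refine (IsUltrametricDist.norm_add_le_max _ _).trans (max_le hMy ?_)
    rw [norm_neg]; exact hy₂.le.trans hM1
  set X : ℝ := ‖x₁‖ with hXdef
  have hX0 : 0 < X := by linarith
  have hM0 : 0 < M := by linarith
  have p3 : X ^ 2 ≤ X ^ 3 := by nlinarith [sq_nonneg X]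
  have hMX2 : M ≤ X ^ 2 := by
    refine (pow_le_pow_iff_left₀ hM0.le (by positivity) two_ne_zero).1 (hMX.trans ?_)
    nlinarith [pow_pos hX0 3]
  have hMX3 : M * X ≤ X ^ 3 := by nlinarith
  have hs : ‖y₂ * x₁ - y₁ * x₂‖ < max X M := by
    refine norm_sub_lt (lt_of_lt_of_le ?_ (le_max_left _ _))
      (lt_of_lt_of_le ?_ (le_max_right _ _)) <;> rw [norm_mul]
    · nlinarith
    · nlinarith [norm_nonneg x₂]
  have hmM : M * max X M ≤ X ^ 3 := by
    rcases max_choice X M with h | h <;> rw [h]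
    · exact hMX3
    · nlinarith
  have hmX : max X M * X ≤ X ^ 3 := by
    rcases max_choice X M with h | h <;> rw [h]
    · nlinarith
    · exact hMX3
  have a1 := norm_coe_lt hW.a₁
  have a3 := norm_coe_lt hW.a₃
  have a4 := norm_coe_lt hW.a₄
  have t2 : ‖(2 : ℚ_[p])‖ ≤ 1 := by exact_mod_cast Padic.norm_int_le_one (p := p) 2
  have hX3 : 0 < X ^ 3 := by positivity
  have hlt : ‖x₃ * (x₁ + x₂) * (x₁ - x₂) ^ 2‖ < X ^ 3 := by
    rw [key]
    refine norm_sub_lt (norm_sub_lt (norm_sub_lt (norm_sub_lt ?_ ?_) ?_) ?_) ?_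
    all_goals simp only [norm_mul, norm_pow, n2]
    · nlinarith [sq_nonneg X, pow_pos hX0 2]
    · rw [← hXdef]
      nlinarith
    · have : ‖y₁ - y₂‖ * ‖y₂ * x₁ - y₁ * x₂‖ < X ^ 3 := by
        refine lt_of_le_of_lt (mul_le_mul_of_nonneg_right hr (norm_nonneg _)) ?_
        exact (mul_lt_mul_of_pos_left hs hM0).trans_le hmM
      refine lt_of_le_of_lt (mul_le_of_le_one_left (by positivity) t2) this
    · have : ‖y₁ - y₂‖ * X ≤ X ^ 3 := by nlinarith
      nlinarith [norm_nonneg (W.a₃ : ℚ_[p])]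
    · have : ‖y₂ * x₁ - y₁ * x₂‖ * X < X ^ 3 := by nlinarith
      have h0 : 0 ≤ ‖y₂ * x₁ - y₁ * x₂‖ * X := by positivity
      nlinarith [norm_nonneg (W.a₁ : ℚ_[p])]
  simp only [norm_mul, norm_pow, n1, n2] at hlt
  by_contra! hc
  nlinarith

theorem reduction_neg {W : WeierstrassCurve ℤ_[p]} (hW : CoeffsDivisible W)
    {P : (genericFiber W).Point} (hP : HasNonsingularReduction W P) :
    HasNonsingularReduction W (-P) := by
  rcases P with _ | ⟨x, y, h⟩
  · exact trivial
  · rw [WeierstrassCurve.Affine.Point.neg_some, reduction_some_iff hW]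
    exact (reduction_some_iff hW h).1 hP

theorem not_reduction_add {W : WeierstrassCurve ℤ_[p]} (hW : CoeffsDivisible W)
    {P Q : (genericFiber W).Point} (hP : HasNonsingularReduction W P)
    (hQ : ¬ HasNonsingularReduction W Q) : ¬ HasNonsingularReduction W (P + Q) := by
  rcases Q with _ | ⟨x₂, y₂, h₂⟩
  · exact absurd trivial hQ
  rcases P with _ | ⟨x₁, y₁, h₁⟩
  · exact fun h => hQ ((zero_add (WeierstrassCurve.Affine.Point.some x₂ y₂ h₂)) ▸ h)
  rw [reduction_some_iff hW] at hP hQ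
  have hne : x₁ ≠ x₂ := by rintro rfl; exact hQ hP
  rw [WeierstrassCurve.Affine.Point.add_of_X_ne hne, reduction_some_iff hW, not_le]
  exact norm_addX_lt hW h₁ h₂ hP (not_le.1 hQ)

/-- The subgroup `E₀(ℚ_p)` of the points that reduce to a nonsingular point of the reduced
curve. -/
def E₀ (W : WeierstrassCurve ℤ_[p]) (hW : CoeffsDivisible W) :
    AddSubgroup (genericFiber W).Point where
  carrier := {P | HasNonsingularReduction W P}
  zero_mem' := trivial
  neg_mem' := reduction_neg hW
  add_mem' {P Q} hP hQ := by
    by_contra h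
    exact not_reduction_add hW (reduction_neg hW hP) h (by rwa [neg_add_cancel_left])

end PointsOfGoodReduction

/-- `ℤ/pℤ` as a `ℤ_p`-module, through the reduction map `ℤ_p → ℤ/pℤ`. -/
noncomputable instance zmodModule (p : ℕ) [Fact p.Prime] : Module ℤ_[p] (ZMod p) :=
  Module.compHom (ZMod p) (PadicInt.toZMod (p := p))

/-- The four special cases; a congruence modulo `m` is divisibility of the difference by `m` in
`ℤ_p`. -/
def IsSpecial {p : ℕ} [Fact p.Prime] (W : WeierstrassCurve ℤ_[p]) : Prop :=
  (p = 2 ∧ (4 : ℤ_[p]) ∣ W.a₁ + W.a₃ - 2) ∨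
  (p = 3 ∧ (9 : ℤ_[p]) ∣ W.a₂ - 6) ∨
  (p = 5 ∧ (25 : ℤ_[p]) ∣ W.a₄ - 10) ∨
  (p = 7 ∧ (49 : ℤ_[p]) ∣ W.a₆ - 14)

end AdditiveReduction

/-! The coordinate `z = -x / y` parametrises all of `E₀`, not only the kernel of reduction. With `w
= -1 / y` the curve becomes `w = z ^ 3 + ...`, where every further term carries some `aᵢ`. Since `p
∣ aᵢ`, each `z` in `ℤ_p` has exactly one integral `w`, by Hensel's lemma. The chord construction in
these coordinates has denominators that are units, and it gives `z (P + Q) ≡ z P + z Q` modulo `p *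
z P * z Q`.

This congruence alone (`IsParameter`) controls the structure. It makes `z` an isometry for a
translation-invariant metric, and multiplication by `p` scales the norm by exactly `‖p‖` wherever
`‖z‖ < 1`. So the kernel `‖z‖ < 1` is a copy of `ℤ_p`, also for `p = 2`, and `E₀` is an extension of
`ℤ/p` by it. Take `P` with `z P = 1`. If `z (p • P)` has valuation exactly one, `P` generates `E₀`
topologically and `E₀ ≅ ℤ_p`. Otherwise `p • P` is `p` times a kernel element, and subtracting that
element from `P` gives a `p`-torsion point that splits the extension.

The valuation is read off modulo `p ^ 2`, where only the part of the group law linear in the `aᵢ`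
matters. It is a combination of the polynomials `((X + Y) ^ n - X ^ n - Y ^ n) / d` with `(n, d) =
(2, 2), (3, 3), (4, 2), (5, 5), (7, 7)`, so summing along the multiples of `P` yields `(p ^ n - p) /
d`. This is divisible by `p` unless `p = d`, whence the four exceptional primes.

Uniqueness of the module structure is density of `ℕ` in `ℤ_p`; existence is transport along the
isomorphism. -/

namespace AdditiveReduction

/-! ### Groups with a `p`-adic parameter -/

section Parameter

variable {p : ℕ} [Fact p.Prime]

/-- A bijection `z` of an abelian group with `ℤ_p` under which the group law is congruent to the
addition, in the sense that `z (P + Q) - z P - z Q` is divisible by `p * z P * z Q`. -/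
structure IsParameter {G : Type*} [AddCommGroup G] (z : G ≃ ℤ_[p]) : Prop where
  norm_add_sub_le (P Q : G) : ‖z (P + Q) - z P - z Q‖ ≤ ‖(p : ℤ_[p])‖ * ‖z P‖ * ‖z Q‖

theorem norm_p_pos : 0 < ‖(p : ℤ_[p])‖ := by
  rw [norm_pos_iff]; exact_mod_cast (Fact.out : p.Prime).ne_zero

theorem norm_p_lt_one : ‖(p : ℤ_[p])‖ < 1 := by
  rw [PadicInt.norm_p]
  exact inv_lt_one_of_one_lt₀ (by exact_mod_cast (Fact.out : p.Prime).one_lt)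

theorem padicInt_norm_add_le (a b : ℤ_[p]) : ‖a + b‖ ≤ max ‖a‖ ‖b‖ :=
  IsUltrametricDist.norm_add_le_max a b

theorem norm_eq_of_norm_sub_lt {a b : ℤ_[p]} (h : ‖a - b‖ < ‖b‖) : ‖a‖ = ‖b‖ := by
  have := IsUltrametricDist.norm_add_eq_max_of_norm_ne_norm (x := a - b) (y := b) h.ne
  rwa [sub_add_cancel, max_eq_right h.le] at this

theorem dvd_of_norm_le {a b : ℤ_[p]} (h : ‖a‖ ≤ ‖b‖) : b ∣ a := by
  rcases ValuationRing.dvd_total b a with hd | ⟨c, rfl⟩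
  · exact hd
  · rcases eq_or_ne a 0 with rfl | ha
    · rw [zero_mul]
    · have h0 : 0 < ‖a‖ := norm_pos_iff.2 ha
      have hc : 1 ≤ ‖c‖ := by
        rw [norm_mul] at h
        exact le_of_mul_le_mul_left (by rwa [mul_one]) h0
      exact ((PadicInt.isUnit_iff.2 ((PadicInt.norm_le_one c).antisymm hc)).mul_right_dvd).2 dvd_rfl

theorem norm_le_of_dvd {a b : ℤ_[p]} (h : b ∣ a) : ‖a‖ ≤ ‖b‖ := by
  obtain ⟨c, rfl⟩ := h
  rw [norm_mul]
  exact mul_le_of_le_one_right (norm_nonneg _) (PadicInt.norm_le_one _)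

theorem norm_le_norm_p {a : ℤ_[p]} (h : ‖a‖ < 1) : ‖a‖ ≤ ‖(p : ℤ_[p])‖ :=
  norm_le_of_dvd ((PadicInt.norm_lt_one_iff_dvd a).1 h)

theorem norm_natCast_eq_one_of_coprime {m : ℕ} (h : ¬ p ∣ m) : ‖(m : ℤ_[p])‖ = 1 := by
  rw [PadicInt.norm_natCast_eq_one_iff]
  exact (Nat.Prime.coprime_iff_not_dvd Fact.out).2 h

/-- Division with remainder in `ℤ_p`: if `u` divides `c`, then `c` is congruent to a natural
multiple of `u` modulo `p * u`. -/
theorem exists_nat_norm_sub_mul_le {c u : ℤ_[p]} (h : ‖c‖ ≤ ‖u‖) :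
    ∃ j : ℕ, ‖c - j * u‖ ≤ ‖(p : ℤ_[p])‖ * ‖u‖ := by
  obtain ⟨d, rfl⟩ := dvd_of_norm_le h
  obtain ⟨j, hj⟩ := PadicInt.denseRange_natCast.exists_dist_lt d one_pos
  refine ⟨j, ?_⟩
  rw [dist_eq_norm] at hj
  rw [show u * d - j * u = (d - j) * u by ring, norm_mul]
  exact mul_le_mul_of_nonneg_right (norm_le_norm_p hj) (norm_nonneg _)

namespace IsParameter

variable {G : Type*} [AddCommGroup G] {z : G ≃ ℤ_[p]}

theorem map_zero (hz : IsParameter z) : z 0 = 0 := by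
  by_contra h
  have h1 := hz.norm_add_sub_le 0 0
  rw [add_zero, sub_self, zero_sub, norm_neg] at h1
  have h0 : 0 < ‖z 0‖ := norm_pos_iff.2 h
  nlinarith [PadicInt.norm_le_one (z 0), norm_p_lt_one (p := p), norm_p_pos (p := p),
    mul_le_mul_of_nonneg_left (PadicInt.norm_le_one (z 0)) (norm_p_pos (p := p)).le]

theorem map_eq_zero_iff (hz : IsParameter z) {P : G} : z P = 0 ↔ P = 0 := by
  rw [← hz.map_zero, z.apply_eq_iff_eq]

/-- In the congruence for `(P - Q) + Q` the error is strictly smaller than `z (P - Q)`, so the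
ultrametric inequality decides. Thus `‖z (P - Q)‖` is a translation-invariant metric, and the balls
around zero are subgroups. -/
theorem norm_sub (hz : IsParameter z) (P Q : G) : ‖z P - z Q‖ = ‖z (P - Q)‖ := by
  rcases eq_or_ne (z (P - Q)) 0 with h | h
  · rw [h, sub_eq_zero.1 (hz.map_eq_zero_iff.1 h), sub_self]
  · have h0 : 0 < ‖z (P - Q)‖ := norm_pos_iff.2 h
    apply norm_eq_of_norm_sub_lt
    have h1 := hz.norm_add_sub_le (P - Q) Q
    rw [sub_add_cancel, sub_right_comm] at h1
    refine h1.trans_lt ?_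
    have h2 := norm_p_lt_one (p := p)
    have h3 := norm_p_pos (p := p)
    have h4 := PadicInt.norm_le_one (z Q)
    have h5 : ‖(p : ℤ_[p])‖ * ‖z (P - Q)‖ < ‖z (P - Q)‖ := by nlinarith
    have h6 : 0 ≤ ‖(p : ℤ_[p])‖ * ‖z (P - Q)‖ := by positivity
    nlinarith

theorem norm_neg (hz : IsParameter z) (P : G) : ‖z (-P)‖ = ‖z P‖ := by
  rw [← zero_sub, ← hz.norm_sub, hz.map_zero, zero_sub, _root_.norm_neg]

theorem norm_add_le (hz : IsParameter z) (P Q : G) : ‖z (P + Q)‖ ≤ max ‖z P‖ ‖z Q‖ := by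
  rw [← sub_neg_eq_add, ← hz.norm_sub, ← hz.norm_neg Q, sub_eq_add_neg,
    ← _root_.norm_neg (z (-Q))]
  exact padicInt_norm_add_le _ _

theorem norm_sub_le (hz : IsParameter z) (P Q : G) : ‖z (P - Q)‖ ≤ max ‖z P‖ ‖z Q‖ := by
  rw [sub_eq_add_neg, ← hz.norm_neg Q]
  exact hz.norm_add_le _ _

theorem norm_nsmul_le (hz : IsParameter z) (k : ℕ) (P : G) : ‖z (k • P)‖ ≤ ‖z P‖ := by
  induction k with
  | zero => rw [zero_smul, hz.map_zero, norm_zero]; exact norm_nonneg _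
  | succ k ih => rw [succ_nsmul]; exact (hz.norm_add_le _ _).trans (max_le ih le_rfl)

theorem norm_nsmul_sub_le (hz : IsParameter z) (k : ℕ) (P : G) :
    ‖z (k • P) - k * z P‖ ≤ ‖(p : ℤ_[p])‖ * ‖z P‖ * ‖z P‖ := by
  induction k with
  | zero =>
    rw [zero_smul, hz.map_zero, Nat.cast_zero, zero_mul, sub_zero, norm_zero]
    positivity
  | succ k ih =>
    rw [succ_nsmul, Nat.cast_succ, show z (k • P + P) - (k + 1 : ℤ_[p]) * z P =
      (z (k • P + P) - z (k • P) - z P) + (z (k • P) - k * z P) by ring]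
    refine (padicInt_norm_add_le _ _).trans (max_le ((hz.norm_add_sub_le _ _).trans ?_) ih)
    gcongr
    exact hz.norm_nsmul_le k P

/-- The error `‖p‖ * ‖z P‖ ^ 2` is dominated by `p * z P` only when `‖z P‖ < 1`. At a unit both have
the same size, and this borderline case separates the two isomorphism types. -/
theorem norm_p_nsmul (hz : IsParameter z) {P : G} (hP : ‖z P‖ < 1) :
    ‖z (p • P)‖ = ‖(p : ℤ_[p])‖ * ‖z P‖ := by
  rcases eq_or_ne (z P) 0 with h | h
  · rw [hz.map_eq_zero_iff.1 h, smul_zero, hz.map_zero, norm_zero, mul_zero]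
  · rw [← norm_mul]
    apply norm_eq_of_norm_sub_lt
    refine (hz.norm_nsmul_sub_le p P).trans_lt ?_
    rw [norm_mul]
    exact mul_lt_of_lt_one_right (mul_pos norm_p_pos (norm_pos_iff.2 h)) hP

theorem norm_nsmul_of_not_dvd (hz : IsParameter z) {k : ℕ} (hk : ¬ p ∣ k) (P : G) :
    ‖z (k • P)‖ = ‖z P‖ := by
  rcases eq_or_ne (z P) 0 with h | h
  · rw [hz.map_eq_zero_iff.1 h, smul_zero]
  · have h0 : 0 < ‖z P‖ := norm_pos_iff.2 h
    have e : ‖(k : ℤ_[p]) * z P‖ = ‖z P‖ := by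
      rw [norm_mul, norm_natCast_eq_one_of_coprime hk, one_mul]
    rw [← e]
    apply norm_eq_of_norm_sub_lt
    refine (hz.norm_nsmul_sub_le k P).trans_lt ?_
    rw [e, mul_assoc]
    have : ‖z P‖ * ‖z P‖ ≤ ‖z P‖ := mul_le_of_le_one_left h0.le (PadicInt.norm_le_one _)
    nlinarith [norm_p_lt_one (p := p), norm_p_pos (p := p)]

/-- The point `P` generates a subgroup on which the parameter is an isometry. -/
structure IsGenerator (z : G ≃ ℤ_[p]) (P : G) : Prop where
  norm_eq_one : ‖z P‖ = 1
  norm_p_nsmul : ‖z (p • P)‖ = ‖(p : ℤ_[p])‖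

theorem norm_pow_nsmul (hz : IsParameter z) {P : G} (hP : IsGenerator z P) (n : ℕ) :
    ‖z (p ^ n • P)‖ = ‖(p : ℤ_[p])‖ ^ n := by
  induction n with
  | zero => rw [pow_zero, one_smul, hP.norm_eq_one, pow_zero]
  | succ n ih =>
    -- The first multiplication by `p` starts outside the kernel, so it needs the hypothesis on `p •
    -- P`; all later ones take place inside it.
    rcases n with _ | n
    · rw [zero_add, pow_one, pow_one, hP.norm_p_nsmul]
    · rw [pow_succ', mul_smul, hz.norm_p_nsmul, ih, ← pow_succ']
      rw [ih]
      exact pow_lt_one₀ (norm_nonneg _) norm_p_lt_one n.succ_ne_zero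

theorem norm_nsmul (hz : IsParameter z) {P : G} (hP : IsGenerator z P) (k : ℕ) :
    ‖z (k • P)‖ = ‖(k : ℤ_[p])‖ := by
  rcases eq_or_ne k 0 with rfl | hk
  · rw [zero_smul, hz.map_zero, Nat.cast_zero]
  · obtain ⟨n, m, hm, rfl⟩ := Nat.exists_eq_pow_mul_and_not_dvd hk p (Fact.out : p.Prime).ne_one
    rw [mul_comm, mul_smul, hz.norm_nsmul_of_not_dvd hm, hz.norm_pow_nsmul hP, Nat.cast_mul,
      norm_mul, norm_natCast_eq_one_of_coprime hm, one_mul, Nat.cast_pow, norm_pow]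

theorem norm_zsmul (hz : IsParameter z) {P : G} (hP : IsGenerator z P) (k : ℤ) :
    ‖z (k • P)‖ = ‖(k : ℤ_[p])‖ := by
  obtain ⟨n, rfl | rfl⟩ := k.eq_nat_or_neg
  · rw [natCast_zsmul, hz.norm_nsmul hP, Int.cast_natCast]
  · rw [neg_smul, hz.norm_neg, natCast_zsmul, hz.norm_nsmul hP, Int.cast_neg, Int.cast_natCast,
      _root_.norm_neg]

/-- Successive approximation: `p ^ n • P` has norm exactly `‖p‖ ^ n`, so a suitable multiple of it
removes the next `p`-adic digit of the remainder. -/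
theorem exists_nat_norm_sub_nsmul_le (hz : IsParameter z) {P : G} (hP : IsGenerator z P) (Q : G)
    (n : ℕ) : ∃ k : ℕ, ‖z (Q - k • P)‖ ≤ ‖(p : ℤ_[p])‖ ^ n := by
  induction n with
  | zero => exact ⟨0, by rw [pow_zero]; exact PadicInt.norm_le_one _⟩
  | succ n ih =>
    obtain ⟨k, hk⟩ := ih
    have hn := hz.norm_pow_nsmul hP n
    obtain ⟨j, hj⟩ := exists_nat_norm_sub_mul_le (hk.trans hn.ge)
    refine ⟨k + j * p ^ n, ?_⟩
    rw [add_smul, mul_smul, ← sub_sub, ← hz.norm_sub,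
      show z (Q - k • P) - z (j • p ^ n • P) = (z (Q - k • P) - j * z (p ^ n • P)) +
        -(z (j • p ^ n • P) - j * z (p ^ n • P)) by ring]
    refine (padicInt_norm_add_le _ _).trans (max_le ?_ ?_)
    · rwa [hn, ← pow_succ'] at hj
    · rw [_root_.norm_neg]
      refine (hz.norm_nsmul_sub_le j _).trans ?_
      rw [pow_succ', ← hn]
      exact mul_le_of_le_one_right (by positivity) (PadicInt.norm_le_one _)

section Topology

variable [TopologicalSpace G]

/-- By `norm_sub`, addition and negation become 1-Lipschitz when read through `z`. -/
theorem isTopologicalAddGroup (hz : IsParameter z) (hc : IsHomeomorph z) :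
    IsTopologicalAddGroup G where
  continuous_add := by
    have h : LipschitzWith 1 fun a : ℤ_[p] × ℤ_[p] => z (z.symm a.1 + z.symm a.2) := by
      refine LipschitzWith.of_dist_le_mul fun a b => ?_
      rw [dist_eq_norm, hz.norm_sub, NNReal.coe_one, one_mul, Prod.dist_eq, dist_eq_norm,
        dist_eq_norm, add_sub_add_comm]
      refine (hz.norm_add_le _ _).trans_eq ?_
      rw [← hz.norm_sub, ← hz.norm_sub]
      simp only [Equiv.apply_symm_apply]
    rw [hc.isInducing.continuous_iff]
    exact (h.continuous.comp (hc.continuous.prodMap hc.continuous)).congr fun a => by simp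
  continuous_neg := by
    have h : LipschitzWith 1 fun a : ℤ_[p] => z (-z.symm a) := by
      refine LipschitzWith.of_dist_le_mul fun a b => ?_
      rw [dist_eq_norm, hz.norm_sub, NNReal.coe_one, one_mul, dist_comm, dist_eq_norm,
        neg_sub_neg, ← hz.norm_sub]
      simp only [Equiv.apply_symm_apply, le_refl]
    rw [hc.isInducing.continuous_iff]
    exact (h.continuous.comp hc.continuous).congr fun a => by simp

/-- A group with a parameter and a generator is isomorphic to `ℤ_p`. -/
theorem exists_addEquiv (hz : IsParameter z) (hc : IsHomeomorph z) {P : G}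
    (hP : IsGenerator z P) : ∃ e : ℤ_[p] ≃+ G, Continuous e ∧ ∀ a, ‖z (e a)‖ = ‖a‖ := by
  have := hz.isTopologicalAddGroup hc
  have : T2Space G := (hc.homeomorph z).symm.t2Space
  have : CompactSpace G := (hc.homeomorph z).symm.compactSpace
  -- The closure of the graph of `k ↦ k • P`. The norm equality holds on the graph, hence on `H`,
  -- and makes both projections injective. Compactness of `H` and density of the multiples make them
  -- surjective, so `H` is the graph of the isomorphism.
  let H : AddSubgroup (ℤ_[p] × G) := (AddSubgroup.zmultiples ((1 : ℤ_[p]), P)).topologicalClosure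
  have hclosed : IsClosed (H : Set (ℤ_[p] × G)) := AddSubgroup.isClosed_topologicalClosure _
  have hmem (k : ℤ) : ((k : ℤ_[p]), k • P) ∈ H :=
    AddSubgroup.le_topologicalClosure _ ⟨k, by simp⟩
  have hnorm : ∀ x ∈ H, ‖z x.2‖ = ‖x.1‖ := by
    intro x hx
    have hs : IsClosed {x : ℤ_[p] × G | ‖z x.2‖ = ‖x.1‖} :=
      isClosed_eq (hc.continuous.comp continuous_snd).norm continuous_fst.norm
    refine closure_minimal ?_ hs hx
    rintro _ ⟨k, rfl⟩
    simpa using hz.norm_zsmul hP k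
  have hcompact : IsCompact (H : Set (ℤ_[p] × G)) := hclosed.isCompact
  let f : H →+ ℤ_[p] := (AddMonoidHom.fst ℤ_[p] G).comp H.subtype
  let g : H →+ G := (AddMonoidHom.snd ℤ_[p] G).comp H.subtype
  have hfg (x : H) : ‖z (g x)‖ = ‖f x‖ := hnorm x x.2
  have hf : Function.Bijective f := by
    constructor
    · rw [injective_iff_map_eq_zero]
      intro x hx
      have h2 := hfg x
      rw [hx, norm_zero, norm_eq_zero, hz.map_eq_zero_iff] at h2
      exact Subtype.ext (Prod.ext hx h2)
    · intro a
      have himage : IsClosed (Prod.fst '' (H : Set (ℤ_[p] × G))) :=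
        (hcompact.image continuous_fst).isClosed
      have : a ∈ Prod.fst '' (H : Set (ℤ_[p] × G)) := by
        refine closure_minimal ?_ himage (PadicInt.denseRange_intCast a)
        rintro _ ⟨k, rfl⟩
        exact ⟨_, hmem k, rfl⟩
      obtain ⟨x, hx, rfl⟩ := this
      exact ⟨⟨x, hx⟩, rfl⟩
  have hg : Function.Bijective g := by
    constructor
    · rw [injective_iff_map_eq_zero]
      intro x hx
      have h2 := hfg x
      rw [hx, hz.map_zero, norm_zero, eq_comm, norm_eq_zero] at h2
      exact Subtype.ext (Prod.ext h2 hx)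
    · intro Q
      have himage : IsClosed (Prod.snd '' (H : Set (ℤ_[p] × G))) :=
        (hcompact.image continuous_snd).isClosed
      have : Q ∈ Prod.snd '' (H : Set (ℤ_[p] × G)) := by
        rw [← himage.closure_eq, hc.isInducing.closure_eq_preimage_closure_image,
          Set.mem_preimage, Metric.mem_closure_iff]
        intro ε hε
        obtain ⟨n, hn⟩ := exists_pow_lt_of_lt_one hε (norm_p_lt_one (p := p))
        obtain ⟨k, hk⟩ := hz.exists_nat_norm_sub_nsmul_le hP Q n
        refine ⟨z (k • P), ⟨k • P, ⟨_, hmem k, by simp⟩, rfl⟩, ?_⟩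
        rw [dist_eq_norm, hz.norm_sub]
        exact hk.trans_lt hn
      obtain ⟨x, hx, rfl⟩ := this
      exact ⟨⟨x, hx⟩, rfl⟩
  let e := (AddEquiv.ofBijective f hf).symm.trans (AddEquiv.ofBijective g hg)
  have he (a : ℤ_[p]) : ‖z (e a)‖ = ‖a‖ := by
    change ‖z (g ((AddEquiv.ofBijective f hf).symm a))‖ = _
    rw [hfg]
    exact congrArg _ ((AddEquiv.ofBijective f hf).apply_symm_apply a)
  refine ⟨e, ?_, he⟩
  rw [hc.isInducing.continuous_iff]
  refine (Isometry.of_dist_eq fun a b => ?_).continuous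
  rw [dist_eq_norm, dist_eq_norm, ← he (a - b), map_sub, ← hz.norm_sub]
  rfl

end Topology

end IsParameter

end Parameter

/-! ### Extensions of `ℤ/p` by the kernel, and continuous `ℤ_p`-module structures -/

section Structure

variable {p : ℕ} [Fact p.Prime]

namespace IsParameter

variable {G : Type*} [AddCommGroup G] {z : G ≃ ℤ_[p]}

/-- The subgroup where the parameter is divisible by `p`. -/
def kernel (hz : IsParameter z) : AddSubgroup G where
  carrier := {P | ‖z P‖ < 1}
  zero_mem' := by simp [hz.map_zero]
  add_mem' {P Q} hP hQ := (hz.norm_add_le P Q).trans_lt (max_lt hP hQ)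
  neg_mem' {P} hP := by rwa [Set.mem_ofPred_eq, hz.norm_neg]

theorem mem_kernel (hz : IsParameter z) {P : G} : P ∈ hz.kernel ↔ ‖z P‖ < 1 := Iff.rfl

variable [TopologicalSpace G]

/-- The kernel has a parameter of its own. -/
theorem exists_kernel_parameter (hz : IsParameter z) (hc : IsHomeomorph z) :
    ∃ z₁ : hz.kernel ≃ ℤ_[p], IsParameter z₁ ∧ IsHomeomorph z₁ ∧
      ∀ P : hz.kernel, z P = p * z₁ P := by
  have : T2Space G := (hc.homeomorph z).symm.t2Space
  have hlt (a : ℤ_[p]) : ‖(p : ℤ_[p]) * a‖ < 1 :=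
    (norm_le_of_dvd (Dvd.intro _ rfl)).trans_lt norm_p_lt_one
  have hp0 : (p : ℤ_[p]) ≠ 0 := norm_pos_iff.1 norm_p_pos
  let u (a : ℤ_[p]) : hz.kernel :=
    ⟨z.symm (p * a), by rw [mem_kernel, Equiv.apply_symm_apply]; exact hlt a⟩
  have hzu (a : ℤ_[p]) : z (u a) = p * a := z.apply_symm_apply _
  have hu : Function.Bijective u := by
    constructor
    · intro a b hab
      have h := congrArg (fun P : hz.kernel => z P) hab
      simp only [hzu] at h
      exact mul_left_cancel₀ hp0 h
    · rintro ⟨P, hP⟩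
      obtain ⟨a, ha⟩ := (PadicInt.norm_lt_one_iff_dvd _).1 hP
      exact ⟨a, Subtype.ext (z.injective ((hzu a).trans ha.symm))⟩
  have huc : Continuous u := by
    rw [(hc.isInducing.comp .subtypeVal).continuous_iff]
    exact (continuous_const.mul continuous_id).congr fun a => (hzu a).symm
  let z₁ : hz.kernel ≃ ℤ_[p] := (Equiv.ofBijective u hu).symm
  have hz₁ (P : hz.kernel) : z P = p * z₁ P := by
    rw [← hzu]
    exact congrArg (fun P : hz.kernel => z P) ((Equiv.ofBijective u hu).apply_symm_apply P).symm
  refine ⟨z₁, ⟨fun P Q => ?_⟩, ?_, hz₁⟩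
  · have h := hz.norm_add_sub_le P Q
    rw [← AddSubgroup.coe_add, hz₁, hz₁, hz₁, ← mul_sub, ← mul_sub, norm_mul, norm_mul,
      norm_mul] at h
    have h0 := norm_p_pos (p := p)
    have h1 : ‖z₁ (P + Q) - z₁ P - z₁ Q‖ ≤
        ‖(p : ℤ_[p])‖ * (‖(p : ℤ_[p])‖ * ‖z₁ P‖ * ‖z₁ Q‖) :=
      le_of_mul_le_mul_left (h.trans_eq (by ring)) h0
    exact h1.trans (mul_le_of_le_one_left (by positivity) norm_p_lt_one.le)
  · exact (Continuous.homeoOfEquivCompactToT2 (f := Equiv.ofBijective u hu) huc).symm.isHomeomorph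

/-- The kernel is isomorphic to `ℤ_p`. -/
theorem exists_kernel_addEquiv (hz : IsParameter z) (hc : IsHomeomorph z) :
    ∃ e : ℤ_[p] ≃+ hz.kernel, Continuous e ∧ ∀ a, ‖z (e a)‖ = ‖(p : ℤ_[p])‖ * ‖a‖ := by
  obtain ⟨z₁, h₁, hc₁, hzz⟩ := hz.exists_kernel_parameter hc
  have hp := norm_p_pos (p := p)
  -- Inside the kernel multiplication by `p` always scales exactly, so any point with `z₁ = 1` is a
  -- generator.
  have hgen : IsGenerator z₁ (z₁.symm 1) := by
    refine ⟨by simp, ?_⟩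
    have hlt := (z₁.symm 1).2
    rw [mem_kernel] at hlt
    have h := hz.norm_p_nsmul hlt
    rw [← AddSubgroup.coe_nsmul, hzz, hzz, norm_mul, norm_mul, Equiv.apply_symm_apply,
      norm_one, mul_one] at h
    exact mul_left_cancel₀ hp.ne' h
  obtain ⟨e, he, hn⟩ := h₁.exists_addEquiv hc₁ hgen
  exact ⟨e, he, fun a => by rw [hzz, norm_mul, hn]⟩

/-- A point outside the kernel whose `p`-fold multiple lies deep enough can be corrected to a
`p`-torsion point. -/
theorem exists_torsion (hz : IsParameter z) (hc : IsHomeomorph z) {P : G} (hP : ‖z P‖ = 1)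
    (hpP : ‖z (p • P)‖ < ‖(p : ℤ_[p])‖) : ∃ T : G, ‖z T‖ = 1 ∧ p • T = 0 := by
  obtain ⟨e, -, hn⟩ := hz.exists_kernel_addEquiv hc
  have hp := norm_p_pos (p := p)
  obtain ⟨a, ha⟩ := e.surjective ⟨p • P, hz.mem_kernel.2 (hpP.trans norm_p_lt_one)⟩
  have hna := hn a
  rw [ha] at hna
  have hlt : ‖a‖ < 1 := by
    rw [hna] at hpP
    exact lt_of_mul_lt_mul_left (by rwa [mul_one]) hp.le
  obtain ⟨b, rfl⟩ := (PadicInt.norm_lt_one_iff_dvd a).1 hlt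
  -- Here `p • P = e (p * b) = p • e b`, and subtracting a kernel element leaves the unit norm of `z
  -- P` unchanged.
  refine ⟨P - e b, ?_, ?_⟩
  · rw [← hz.norm_sub, ← hP]
    apply norm_eq_of_norm_sub_lt
    rw [sub_sub_cancel_left, _root_.norm_neg, hP]
    exact (e b).2
  · rw [smul_sub, ← AddSubgroup.coe_nsmul, ← map_nsmul, nsmul_eq_mul, ha, sub_self]

/-- A group with a parameter and a `p`-torsion point outside the kernel is isomorphic to
`ℤ_p × ℤ/pℤ`. -/
theorem exists_addEquiv_prod (hz : IsParameter z) (hc : IsHomeomorph z) {T : G} (hT : ‖z T‖ = 1)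
    (hpT : p • T = 0) : ∃ e : ℤ_[p] × ZMod p ≃+ G, Continuous e := by
  have := hz.isTopologicalAddGroup hc
  obtain ⟨e, he, -⟩ := hz.exists_kernel_addEquiv hc
  let t : ZMod p →+ G := ZMod.lift p ⟨zmultiplesHom G T, by simpa using hpT⟩
  have ht (k : ℕ) : t (k : ZMod p) = k • T := by
    have := ZMod.lift_coe p ⟨zmultiplesHom G T, by simpa using hpT⟩ (k : ℤ)
    simpa using this
  let f : ℤ_[p] × ZMod p →+ G := (hz.kernel.subtype.comp e.toAddMonoidHom).coprod t
  have hf (a : ℤ_[p]) (k : ZMod p) : f (a, k) = e a + t k := rfl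
  have hbij : Function.Bijective f := by
    constructor
    · rw [injective_iff_map_eq_zero]
      rintro ⟨a, k⟩ h
      obtain ⟨n, rfl⟩ := ZMod.natCast_zmod_surjective k
      rw [hf, ht] at h
      have hk : p ∣ n := by
        by_contra hk
        have h1 := hz.norm_nsmul_of_not_dvd hk T
        have h2 : n • T = ((-e a : hz.kernel) : G) := by
          rw [AddSubgroup.coe_neg]; exact eq_neg_of_add_eq_zero_right h
        rw [h2, hT] at h1
        exact (hz.mem_kernel.1 (-e a).2).ne h1
      rw [← ht, (ZMod.natCast_eq_zero_iff n p).2 hk, _root_.map_zero, add_zero] at h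
      have h3 : e a = 0 := Subtype.ext h
      rw [(ZMod.natCast_eq_zero_iff n p).2 hk, (EmbeddingLike.map_eq_zero_iff (f := e)).1 h3]
      rfl
    · intro Q
      obtain ⟨j, hj⟩ := exists_nat_norm_sub_mul_le
        ((PadicInt.norm_le_one (z Q)).trans hT.ge)
      have hmem : Q - j • T ∈ hz.kernel := by
        rw [mem_kernel, ← hz.norm_sub, show z Q - z (j • T) =
          (z Q - j * z T) + -(z (j • T) - j * z T) by ring]
        refine (padicInt_norm_add_le _ _).trans_lt (max_lt ?_ ?_)
        · rw [hT, mul_one] at hj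
          exact hj.trans_lt norm_p_lt_one
        · rw [_root_.norm_neg]
          refine (hz.norm_nsmul_sub_le j T).trans_lt ?_
          rw [hT, mul_one, mul_one]
          exact norm_p_lt_one
      refine ⟨(e.symm ⟨_, hmem⟩, (j : ZMod p)), ?_⟩
      rw [hf, ht, e.apply_symm_apply, sub_add_cancel]
  refine ⟨AddEquiv.ofBijective f hbij, ?_⟩
  exact ((continuous_subtype_val.comp he).comp continuous_fst).add
    ((continuous_of_discreteTopology (f := t)).comp continuous_snd)

end IsParameter

instance continuousSMul_zmod : ContinuousSMul ℤ_[p] (ZMod p) where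
  continuous_smul := by
    have h : Continuous (PadicInt.toZMod (p := p)) := by
      refine continuous_iff_continuousAt.2 fun a => ?_
      refine (continuousAt_const (y := PadicInt.toZMod a)).congr ?_
      filter_upwards [Metric.ball_mem_nhds a one_pos] with b hb
      rw [Metric.mem_ball, dist_comm, dist_eq_norm] at hb
      rw [← sub_eq_zero, ← map_sub, toZMod_eq_zero_iff, PadicInt.padic_norm_e_of_padicInt]
      exact hb
    exact (h.comp continuous_fst).mul continuous_snd

/-- Continuous `ℤ_p`-module structures are determined by the group. -/
theorem continuousSMul_ext {G : Type*} [AddCommGroup G] [TopologicalSpace G] [T2Space G]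
    (M N : Module ℤ_[p] G) (hM : letI := M; ContinuousSMul ℤ_[p] G)
    (hN : letI := N; ContinuousSMul ℤ_[p] G) : M = N := by
  refine Module.ext' M N fun a P => ?_
  have h1 : Continuous fun a : ℤ_[p] => (letI := M; a • P) :=
    letI := M; continuous_id.smul continuous_const
  have h2 : Continuous fun a : ℤ_[p] => (letI := N; a • P) :=
    letI := N; continuous_id.smul continuous_const
  refine congrFun (PadicInt.denseRange_natCast.equalizer h1 h2 (funext fun n => ?_)) a
  exact (letI := M; Nat.cast_smul_eq_nsmul ℤ_[p] n P).trans
    (letI := N; Nat.cast_smul_eq_nsmul ℤ_[p] n P).symm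

/-- A topological group isomorphic to a compact `ℤ_p`-module has exactly one continuous module
structure, and is isomorphic to the given module for that structure. -/
theorem existsUnique_module_of_addEquiv {G M : Type*} [AddCommGroup G] [TopologicalSpace G]
    [T2Space G] [AddCommGroup M] [Module ℤ_[p] M] [TopologicalSpace M] [CompactSpace M]
    [ContinuousSMul ℤ_[p] M] (e : M ≃+ G) (he : Continuous e) :
    (∃! N : Module ℤ_[p] G, letI := N; ContinuousSMul ℤ_[p] G) ∧
      ∀ [Module ℤ_[p] G] [ContinuousSMul ℤ_[p] G], Nonempty (G ≃ₗ[ℤ_[p]] M) := by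
  have hs : Continuous e.symm :=
    (Continuous.homeoOfEquivCompactToT2 (f := e.toEquiv) he).symm.continuous
  let N : Module ℤ_[p] G := e.symm.module ℤ_[p]
  have hN : letI := N; ContinuousSMul ℤ_[p] G := by
    let := N
    exact ⟨he.comp (continuous_fst.smul (hs.comp continuous_snd))⟩
  refine ⟨⟨N, hN, fun N' hN' => continuousSMul_ext N' N hN' hN⟩, ?_⟩
  intro N' hN'
  obtain rfl : N' = N := continuousSMul_ext N' N hN' hN
  exact ⟨{ e.symm with map_smul' := fun a P => e.symm_apply_apply (a • e.symm P) }⟩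

end Structure

/-! ### The chord construction in the coordinates `z = -x / y` and `w = -1 / y` -/

section Chart

variable {K : Type*} [Field K] (E : WeierstrassCurve.Affine K)

/-- The point has coordinates `z = -x / y` and `w = -1 / y`. -/
def HasChart : E.Point → K → K → Prop
  | .zero, z, w => z = 0 ∧ w = 0
  | .some x y _, z, w => x * w = z ∧ y * w = -1

/-- The Weierstrass equation in the coordinates `z` and `w`. -/
def ChartEquation {R : Type*} [CommRing R] (W : WeierstrassCurve R) (z w : R) : Prop :=
  w = z ^ 3 + W.a₁ * z * w + W.a₂ * z ^ 2 * w + W.a₃ * w ^ 2 + W.a₄ * z * w ^ 2 + W.a₆ * w ^ 3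

variable {E}

theorem HasChart.equation {P : E.Point} {z w : K} (h : HasChart E P z w) :
    ChartEquation E z w := by
  rcases P with _ | ⟨x, y, hxy⟩
  · obtain ⟨rfl, rfl⟩ := h
    simp [ChartEquation]
  · obtain ⟨rfl, hy⟩ := h
    have e := (E.equation_iff x y).1 hxy.1
    have e1 : y ^ 2 * w ^ 3 = w := by linear_combination (y * w ^ 2 - w) * hy
    rw [ChartEquation]
    linear_combination w ^ 3 * e - e1 - (E.a₁ * x * w ^ 2 + E.a₃ * w ^ 2) * hy

/-- The new ordinate satisfies `(-y - a₁ x - a₃) * w = 1 - a₁ z - a₃ w`, so negation divides `-z`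
and `-w` by this factor. -/
theorem HasChart.neg [DecidableEq K] {P : E.Point} {z w z' w' : K} (h : HasChart E P z w)
    (hz : z' * (1 - E.a₁ * z - E.a₃ * w) = -z) (hw : w' * (1 - E.a₁ * z - E.a₃ * w) = -w)
    (h0 : 1 - E.a₁ * z - E.a₃ * w ≠ 0) : HasChart E (-P) z' w' := by
  rcases P with _ | ⟨x, y, hxy⟩
  · obtain ⟨rfl, rfl⟩ := h
    simp only [mul_zero, sub_zero, mul_one, neg_zero] at hz hw
    exact ⟨hz, hw⟩
  · obtain ⟨rfl, hy⟩ := h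
    rw [WeierstrassCurve.Affine.Point.neg_some]
    refine ⟨mul_right_cancel₀ h0 ?_, mul_right_cancel₀ h0 ?_⟩
    · linear_combination x * hw - hz
    · rw [WeierstrassCurve.Affine.negY]
      linear_combination (-y - E.a₁ * x - E.a₃) * hw + hy

variable [DecidableEq K]

/-- The third point of the curve on the line `w = l * z + n` through two given points. -/
theorem HasChart.neg_add {x₁ y₁ x₂ y₂ z₁ w₁ z₂ w₂ l n z₃ : K} {h₁ : E.Nonsingular x₁ y₁}
    {h₂ : E.Nonsingular x₂ y₂} (c₁ : HasChart E (.some x₁ y₁ h₁) z₁ w₁)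
    (c₂ : HasChart E (.some x₂ y₂ h₂) z₂ w₂) (hw₁ : w₁ = l * z₁ + n) (hw₂ : w₂ = l * z₂ + n)
    (hz₁ : z₁ ≠ 0) (hz₂ : z₂ ≠ 0)
    (hl : l * (1 - E.a₁ * z₂ - E.a₂ * z₂ ^ 2 - E.a₃ * (w₁ + w₂) - E.a₄ * z₂ * (w₁ + w₂)
        - E.a₆ * (w₁ ^ 2 + w₁ * w₂ + w₂ ^ 2)) =
      z₁ ^ 2 + z₁ * z₂ + z₂ ^ 2 + E.a₁ * w₁ + E.a₂ * w₁ * (z₁ + z₂) + E.a₄ * w₁ ^ 2)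
    (hA : 1 + E.a₂ * l + E.a₄ * l ^ 2 + E.a₆ * l ^ 3 ≠ 0)
    (hz₃ : (1 + E.a₂ * l + E.a₄ * l ^ 2 + E.a₆ * l ^ 3) * (z₁ + z₂ + z₃) =
      -(E.a₁ * l + E.a₂ * n + E.a₃ * l ^ 2 + 2 * E.a₄ * l * n + 3 * E.a₆ * l ^ 2 * n)) :
    HasChart E (-(.some x₁ y₁ h₁ + .some x₂ y₂ h₂)) z₃ (l * z₃ + n) := by
  have q₁ := c₁.equation
  have q₂ := c₂.equation
  rw [ChartEquation] at q₁ q₂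
  obtain ⟨hx₁, hy₁⟩ := c₁
  obtain ⟨hx₂, hy₂⟩ := c₂
  have hw₁0 : w₁ ≠ 0 := by rintro rfl; simp at hy₁
  have hw₂0 : w₂ ≠ 0 := by rintro rfl; simp at hy₂
  set A := 1 + E.a₂ * l + E.a₄ * l ^ 2 + E.a₆ * l ^ 3 with hAdef
  set B := E.a₁ * l + E.a₂ * n + E.a₃ * l ^ 2 + 2 * E.a₄ * l * n + 3 * E.a₆ * l ^ 2 * n with hB
  -- Substituting `w = l * z + n` gives the cubic `A z³ + B z² + C z + D`. `f₁` is its value at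
  -- `z₁`, and `f₁₂` is its divided difference, which remains meaningful for a tangent. With `hz₃`
  -- they yield the other Vieta relations `s₂` and `s₃`.
  obtain ⟨C, hC⟩ : ∃ C, C = E.a₁ * n + 2 * E.a₃ * l * n + E.a₄ * n ^ 2 + 3 * E.a₆ * l * n ^ 2 - l :=
    ⟨_, rfl⟩
  obtain ⟨D, hD⟩ : ∃ D, D = E.a₃ * n ^ 2 + E.a₆ * n ^ 3 - n := ⟨_, rfl⟩
  have f₁ : A * z₁ ^ 3 + B * z₁ ^ 2 + C * z₁ + D = 0 := by
    rw [hw₁] at q₁; rw [hAdef, hB, hC, hD]; linear_combination -q₁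
  have f₁₂ : A * (z₁ ^ 2 + z₁ * z₂ + z₂ ^ 2) + B * (z₁ + z₂) + C = 0 := by
    rw [hw₁, hw₂] at hl; rw [hAdef, hB, hC]; linear_combination -hl
  have s₂ : A * (z₁ * z₂ + (z₁ + z₂) * z₃) = C := by
    linear_combination (z₁ + z₂) * hz₃ - f₁₂
  have s₃ : A * (z₁ * z₂ * z₃) = -D := by
    linear_combination z₁ * z₂ * hz₃ + f₁ - z₁ * f₁₂
  have line₁ : n * y₁ = l * x₁ - 1 := by
    linear_combination y₁ * hx₁ * l - y₁ * hw₁ - (l * x₁ - 1) * hy₁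
  have line₂ : n * y₂ = l * x₂ - 1 := by
    linear_combination y₂ * hx₂ * l - y₂ * hw₂ - (l * x₂ - 1) * hy₂
  -- the slope of the tangent line in the affine coordinates
  have tangent (hz : z₁ = z₂) (hw : w₁ = w₂) (hx : x₁ = x₂) (hy : y₁ = y₂) :
      n * (3 * x₁ ^ 2 + 2 * E.a₂ * x₁ + E.a₄ - E.a₁ * y₁) = l * (2 * y₁ + E.a₁ * x₁ + E.a₃) := by
    subst hz hw hx hy
    have hN : n * (3 * z₁ ^ 2 + E.a₁ * w₁ + 2 * E.a₂ * w₁ * z₁ + E.a₄ * w₁ ^ 2) =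
        -(l * w₁ * (2 - E.a₁ * z₁ - E.a₃ * w₁)) := by
      linear_combination 3 * l * q₁ - w₁ * hl - (3 * z₁ ^ 2 + E.a₁ * w₁ + 2 * E.a₂ * w₁ * z₁ +
        E.a₄ * w₁ ^ 2) * hw₁
    rw [← hx₁] at hN
    apply mul_right_cancel₀ (pow_ne_zero 2 hw₁0)
    linear_combination hN - (n * E.a₁ * w₁ + 2 * l * w₁) * hy₁
  have same (hx : x₁ = x₂) (hy : y₁ = y₂) :
      n * (3 * x₁ ^ 2 + 2 * E.a₂ * x₁ + E.a₄ - E.a₁ * y₁) = l * (2 * y₁ + E.a₁ * x₁ + E.a₃) := by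
    have hy₁0 : y₁ ≠ 0 := by rintro rfl; simp at hy₁
    have hw : w₁ = w₂ := mul_left_cancel₀ hy₁0 (by rw [hy₁, hy, hy₂])
    exact tangent (by rw [← hx₁, ← hx₂, hx, hw]) hw hx hy
  -- For `n = 0` the line passes through the origin of the chart, the point at infinity: the two
  -- points are opposite and `z₃ = 0`.
  rcases eq_or_ne n 0 with hn | hn
  · have hz₃0 : z₃ = 0 := by
      have : A * (z₁ * z₂ * z₃) = 0 := by rw [s₃, hD, hn]; ring
      simpa [hA, hz₁, hz₂] using this
    have hl0 : l ≠ 0 := by rintro rfl; exact hw₁0 (by rw [hw₁, hn]; ring)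
    have hx : x₁ = x₂ := by
      apply mul_left_cancel₀ hl0
      linear_combination line₂ - line₁ + (y₁ - y₂) * hn
    have hy : y₁ = E.negY x₂ y₂ := by
      rcases WeierstrassCurve.Affine.Y_eq_of_X_eq h₁.1 h₂.1 hx with hy | hy
      · have h := same hx hy
        rw [hn, zero_mul, eq_comm] at h
        have h := (mul_eq_zero.1 h).resolve_left hl0
        rw [WeierstrassCurve.Affine.negY, ← hx, ← hy]
        linear_combination h
      · exact hy
    rw [WeierstrassCurve.Affine.Point.add_of_Y_eq hx hy, neg_zero, hz₃0, hn]
    exact ⟨rfl, by ring⟩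
  -- Opposite points lie on a line through the origin. With `n ≠ 0` they would have to coincide, and
  -- then the tangent relation makes both partial derivatives vanish.
  · have hxy : ¬(x₁ = x₂ ∧ y₁ = E.negY x₂ y₂) := by
      rintro ⟨hx, hy⟩
      have hz : z₁ = z₂ := by
        apply mul_left_cancel₀ hn
        linear_combination z₂ * hw₁ - z₁ * hw₂ - w₂ * hx₁ + w₁ * hx₂ + w₁ * w₂ * hx
      have hw : w₁ = w₂ := by rw [hw₁, hw₂, hz]
      have hyy : y₁ = y₂ := mul_right_cancel₀ hw₁0 (by rw [hy₁, hw, hy₂])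
      have h2 : 2 * y₁ + E.a₁ * x₁ + E.a₃ = 0 := by
        rw [WeierstrassCurve.Affine.negY, ← hx, ← hyy] at hy
        linear_combination hy
      have h3 := tangent hz hw hx hyy
      rw [h2, mul_zero] at h3
      have h3 := (mul_eq_zero.1 h3).resolve_left hn
      rcases ((E.nonsingular_iff' x₁ y₁).1 h₁).2 with h | h
      · exact h (by linear_combination -h3)
      · exact h h2
    obtain ⟨m, hm⟩ : ∃ m, E.slope x₁ x₂ y₁ y₂ = m := ⟨_, rfl⟩
    -- In affine coordinates the line reads `n * y = l * x - 1`, so its slope is `l / n`.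
    have hml : l = m * n := by
      rw [← hm]
      by_cases hx : x₁ = x₂
      · have hy : y₁ ≠ E.negY x₂ y₂ := fun h => hxy ⟨hx, h⟩
        have hyy := (WeierstrassCurve.Affine.Y_eq_of_X_eq h₁.1 h₂.1 hx).resolve_right hy
        rw [WeierstrassCurve.Affine.slope_of_Y_ne hx hy]
        rw [← hx, ← hyy, ← sub_ne_zero] at hy
        rw [div_mul_eq_mul_div, eq_div_iff hy, WeierstrassCurve.Affine.negY]
        linear_combination -same hx hyy
      · rw [WeierstrassCurve.Affine.slope_of_X_ne hx, div_mul_eq_mul_div,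
          eq_div_iff (sub_ne_zero.2 hx)]
        linear_combination line₂ - line₁
    rw [WeierstrassCurve.Affine.Point.add_some hxy, WeierstrassCurve.Affine.Point.neg_some]
    obtain ⟨w₃, hw₃⟩ : ∃ w₃, l * z₃ + n = w₃ := ⟨_, rfl⟩
    have hprod : A * (w₁ * w₂ * w₃) = n ^ 3 := by
      rw [← hw₃, hw₁, hw₂]
      rw [hD] at s₃
      rw [hC] at s₂
      linear_combination l ^ 3 * s₃ + l ^ 2 * n * s₂ + l * n ^ 2 * hz₃ + n ^ 3 * hAdef -
        l * n ^ 2 * hB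
    have hsum : A * (z₁ * w₂ * w₃ + z₂ * w₁ * w₃ + z₃ * w₁ * w₂) =
        n * (l ^ 2 + E.a₁ * l * n - E.a₂ * n ^ 2) := by
      rw [← hw₃, hw₁, hw₂]
      rw [hD] at s₃
      rw [hC] at s₂
      linear_combination 3 * l ^ 2 * s₃ + 2 * l * n * s₂ + n ^ 2 * hz₃ - n ^ 2 * hB
    have hx₃ : E.addX x₁ x₂ m * w₃ = z₃ := by
      rw [WeierstrassCurve.Affine.addX]
      have h0 : A * w₁ * w₂ * n ^ 2 ≠ 0 :=
        mul_ne_zero (mul_ne_zero (mul_ne_zero hA hw₁0) hw₂0) (pow_ne_zero 2 hn)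
      apply mul_right_cancel₀ h0
      rw [hml] at hsum
      linear_combination n ^ 2 * (m ^ 2 + E.a₁ * m - E.a₂) * hprod - n ^ 2 * hsum -
        A * n ^ 2 * w₂ * w₃ * hx₁ - A * n ^ 2 * w₁ * w₃ * hx₂
    have hy₃ : E.negAddY x₁ x₂ y₁ m * w₃ = -1 := by
      rw [WeierstrassCurve.Affine.negAddY]
      apply mul_left_cancel₀ hn
      linear_combination w₃ * line₁ + n * m * hx₃ + w₃ * x₁ * hml + hw₃ - z₃ * hml
    simp only [hm, hw₃]
    refine ⟨hx₃, ?_⟩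
    rw [WeierstrassCurve.Affine.addY, WeierstrassCurve.Affine.negY_negY]
    exact hy₃

end Chart

/-! ### Integrality of the chord construction when `p` divides the coefficients -/

section Integral

variable {p : ℕ} [Fact p.Prime] {W : WeierstrassCurve ℤ_[p]}

theorem isUnit_one_add {a : ℤ_[p]} (h : (p : ℤ_[p]) ∣ a) : IsUnit (1 + a) := by
  rw [PadicInt.isUnit_iff, ← norm_one (α := ℤ_[p])]
  apply norm_eq_of_norm_sub_lt
  rw [add_sub_cancel_left, norm_one]
  exact (PadicInt.norm_lt_one_iff_dvd a).2 h

/-- The first-order part in the coefficients of the addition law in the coordinate `z`. -/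
def firstOrderCocycle {R : Type*} [CommRing R] (W : WeierstrassCurve R) (X Y : R) : R :=
  -(X * Y) * (W.a₁ + W.a₂ * (X + Y) + W.a₃ * (2 * X ^ 2 + 3 * X * Y + 2 * Y ^ 2) +
    2 * W.a₄ * ((X + Y) * (X ^ 2 + X * Y + Y ^ 2)) +
    3 * W.a₆ * ((X + Y) * (X ^ 2 + X * Y + Y ^ 2) ^ 2))

theorem ChartEquation.eq_mul_isUnit (hW : CoeffsDivisible W) {z w : ℤ_[p]}
    (h : ChartEquation W z w) : ∃ u, IsUnit u ∧ w * u = z ^ 3 := by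
  refine ⟨1 + (W.a₁ * -z + W.a₂ * -z ^ 2 + W.a₃ * -w + W.a₄ * -(z * w) + W.a₆ * -w ^ 2),
    isUnit_one_add ?_, ?_⟩
  · exact ((((hW.a₁.mul_right _).add (hW.a₂.mul_right _)).add (hW.a₃.mul_right _)).add
      (hW.a₄.mul_right _)).add (hW.a₆.mul_right _)
  · rw [ChartEquation] at h
    linear_combination h

theorem ChartEquation.eq_zero_iff (hW : CoeffsDivisible W) {z w : ℤ_[p]}
    (h : ChartEquation W z w) : z = 0 ↔ w = 0 := by
  obtain ⟨u, hu, e⟩ := h.eq_mul_isUnit hW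
  constructor
  · rintro rfl
    simpa [hu.ne_zero] using e
  · rintro rfl
    simpa using e.symm

/-- The slope of the line through two points in the coordinates `z` and `w` is integral. -/
theorem exists_slope (hW : CoeffsDivisible W) {z₁ w₁ z₂ w₂ : ℤ_[p]} (h₁ : ChartEquation W z₁ w₁)
    (h₂ : ChartEquation W z₂ w₂) : ∃ l : ℤ_[p], w₂ - w₁ = l * (z₂ - z₁) ∧
      l * (1 - W.a₁ * z₂ - W.a₂ * z₂ ^ 2 - W.a₃ * (w₁ + w₂) - W.a₄ * z₂ * (w₁ + w₂)
        - W.a₆ * (w₁ ^ 2 + w₁ * w₂ + w₂ ^ 2)) =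
      z₁ ^ 2 + z₁ * z₂ + z₂ ^ 2 + W.a₁ * w₁ + W.a₂ * w₁ * (z₁ + z₂) + W.a₄ * w₁ ^ 2 := by
  have hu : IsUnit (1 + (W.a₁ * -z₂ + W.a₂ * -z₂ ^ 2 + W.a₃ * -(w₁ + w₂) +
      W.a₄ * -(z₂ * (w₁ + w₂)) + W.a₆ * -(w₁ ^ 2 + w₁ * w₂ + w₂ ^ 2))) :=
    isUnit_one_add (((((hW.a₁.mul_right _).add (hW.a₂.mul_right _)).add (hW.a₃.mul_right _)).add
      (hW.a₄.mul_right _)).add (hW.a₆.mul_right _))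
  obtain ⟨l, hl⟩ := hu.dvd (a := z₁ ^ 2 + z₁ * z₂ + z₂ ^ 2 + W.a₁ * w₁ +
    W.a₂ * w₁ * (z₁ + z₂) + W.a₄ * w₁ ^ 2)
  refine ⟨l, ?_, by linear_combination -hl⟩
  apply hu.mul_right_cancel
  rw [ChartEquation] at h₁ h₂
  linear_combination h₂ - h₁ + (z₂ - z₁) * hl

/-- The slope relation `w₂ - w₁ = l * (z₂ - z₁)` does not require `z₁ ≠ z₂`. -/
theorem ChartEquation.unique (hW : CoeffsDivisible W) {z w w' : ℤ_[p]}
    (h : ChartEquation W z w) (h' : ChartEquation W z w') : w = w' := by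
  obtain ⟨l, hl, -⟩ := exists_slope hW h h'
  linear_combination -hl

theorem ChartEquation.norm_sub_le (hW : CoeffsDivisible W) {z₁ w₁ z₂ w₂ : ℤ_[p]}
    (h₁ : ChartEquation W z₁ w₁) (h₂ : ChartEquation W z₂ w₂) : ‖w₂ - w₁‖ ≤ ‖z₂ - z₁‖ := by
  obtain ⟨l, hl, -⟩ := exists_slope hW h₁ h₂
  exact norm_le_of_dvd (Dvd.intro_left _ hl.symm)

/-- Modulo `p` the equation in `w` is `z ^ 3 - w = 0`, with derivative `-1`, so Hensel's lemma lifts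
the approximate root `z ^ 3` for every `z` in `ℤ_p`. -/
theorem exists_chartEquation (hW : CoeffsDivisible W) (z : ℤ_[p]) :
    ∃ w, ChartEquation W z w := by
  let F : Polynomial ℤ_[p] := .C W.a₆ * .X ^ 3 + .C (W.a₃ + W.a₄ * z) * .X ^ 2 +
    .C (W.a₁ * z + W.a₂ * z ^ 2 - 1) * .X + .C (z ^ 3)
  have hF (w : ℤ_[p]) : F.aeval w = W.a₆ * w ^ 3 + (W.a₃ + W.a₄ * z) * w ^ 2 +
      (W.a₁ * z + W.a₂ * z ^ 2 - 1) * w + z ^ 3 := by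
    simp [F]
  have hF' (w : ℤ_[p]) : F.derivative.aeval w = 3 * W.a₆ * w ^ 2 + 2 * (W.a₃ + W.a₄ * z) * w +
      (W.a₁ * z + W.a₂ * z ^ 2 - 1) := by
    simp [F, -map_pow]
    ring
  have h1 : ‖F.derivative.aeval (z ^ 3)‖ = 1 := by
    rw [← PadicInt.isUnit_iff, hF', ← IsUnit.neg_iff]
    convert isUnit_one_add (a := W.a₆ * -(3 * (z ^ 3) ^ 2) + W.a₃ * -(2 * z ^ 3) +
      W.a₄ * -(2 * z * z ^ 3) + W.a₁ * -z + W.a₂ * -z ^ 2) ?_ using 1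
    · ring
    · exact ((((hW.a₆.mul_right _).add (hW.a₃.mul_right _)).add (hW.a₄.mul_right _)).add
        (hW.a₁.mul_right _)).add (hW.a₂.mul_right _)
  have h2 : ‖F.aeval (z ^ 3)‖ < 1 := by
    rw [PadicInt.norm_lt_one_iff_dvd, hF]
    convert ((((hW.a₆.mul_right ((z ^ 3) ^ 3)).add (hW.a₃.mul_right ((z ^ 3) ^ 2))).add
      (hW.a₄.mul_right (z * (z ^ 3) ^ 2))).add (hW.a₁.mul_right (z * z ^ 3))).add
      (hW.a₂.mul_right (z ^ 2 * z ^ 3)) using 1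
    ring
  obtain ⟨w, hw, -⟩ := hensels_lemma (F := F) (a := z ^ 3) (by rw [h1]; simpa using h2)
  refine ⟨w, ?_⟩
  rw [hF] at hw
  rw [ChartEquation]
  linear_combination -hw

/-- The addition law in the coordinate `z`: its difference from the addition is divisible by
`p * z₁ * z₂`, and its first-order part is known. -/
theorem third_point_congruences (hW : CoeffsDivisible W) {z₁ w₁ z₂ w₂ l n z₃ z : ℤ_[p]}
    (h₁ : ChartEquation W z₁ w₁) (hw₁ : w₁ = l * z₁ + n) (hw₂ : w₂ = l * z₂ + n)
    (hl : l * (1 - W.a₁ * z₂ - W.a₂ * z₂ ^ 2 - W.a₃ * (w₁ + w₂) - W.a₄ * z₂ * (w₁ + w₂)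
        - W.a₆ * (w₁ ^ 2 + w₁ * w₂ + w₂ ^ 2)) =
      z₁ ^ 2 + z₁ * z₂ + z₂ ^ 2 + W.a₁ * w₁ + W.a₂ * w₁ * (z₁ + z₂) + W.a₄ * w₁ ^ 2)
    (hz₃ : (1 + W.a₂ * l + W.a₄ * l ^ 2 + W.a₆ * l ^ 3) * (z₁ + z₂ + z₃) =
      -(W.a₁ * l + W.a₂ * n + W.a₃ * l ^ 2 + 2 * W.a₄ * l * n + 3 * W.a₆ * l ^ 2 * n))
    (hz : z * (1 - W.a₁ * z₃ - W.a₃ * (l * z₃ + n)) = -z₃) :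
    (p : ℤ_[p]) * z₁ * z₂ ∣ z - z₁ - z₂ ∧
      (p : ℤ_[p]) ^ 2 ∣ z - z₁ - z₂ - firstOrderCocycle W z₁ z₂ := by
  obtain ⟨b₁, hb₁⟩ := hW.a₁
  obtain ⟨b₂, hb₂⟩ := hW.a₂
  obtain ⟨b₃, hb₃⟩ := hW.a₃
  obtain ⟨b₄, hb₄⟩ := hW.a₄
  obtain ⟨b₆, hb₆⟩ := hW.a₆
  have hp0 : (p : ℤ_[p]) ≠ 0 := norm_pos_iff.1 norm_p_pos
  rw [ChartEquation] at h₁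
  rw [firstOrderCocycle]
  simp only [hb₁, hb₂, hb₃, hb₄, hb₆] at *
  generalize hπ : (p : ℤ_[p]) = π at *
  obtain ⟨s, hs⟩ : ∃ s, s = z₁ + z₂ := ⟨_, rfl⟩
  obtain ⟨A, hA⟩ : ∃ A, A = 1 + π * b₂ * l + π * b₄ * l ^ 2 + π * b₆ * l ^ 3 := ⟨_, rfl⟩
  obtain ⟨U, hU⟩ : ∃ U, U = 1 - π * b₁ * z₃ - π * b₃ * (l * z₃ + n) := ⟨_, rfl⟩
  obtain ⟨V, hV⟩ : ∃ V, V = 1 - π * b₃ * n - π * b₆ * n ^ 2 := ⟨_, rfl⟩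
  have uA : IsUnit A := by
    rw [hA, show 1 + π * b₂ * l + π * b₄ * l ^ 2 + π * b₆ * l ^ 3 =
      1 + π * (b₂ * l + b₄ * l ^ 2 + b₆ * l ^ 3) by ring, ← hπ]
    exact isUnit_one_add (Dvd.intro _ rfl)
  have uU : IsUnit U := by
    rw [hU, show 1 - π * b₁ * z₃ - π * b₃ * (l * z₃ + n) =
      1 + π * (-b₁ * z₃ - b₃ * (l * z₃ + n)) by ring, ← hπ]
    exact isUnit_one_add (Dvd.intro _ rfl)
  have uV : IsUnit V := by
    rw [hV, show 1 - π * b₃ * n - π * b₆ * n ^ 2 = 1 + π * (-b₃ * n - b₆ * n ^ 2) by ring, ← hπ]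
    exact isUnit_one_add (Dvd.intro _ rfl)
  -- `E` is what remains of `z - z₁ - z₂` after clearing the unit denominators `A` and `U` and
  -- extracting one factor `p`.
  obtain ⟨E, hE⟩ : ∃ E, E = (b₁ * l + b₂ * n + b₃ * l ^ 2 + 2 * b₄ * l * n + 3 * b₆ * l ^ 2 * n) *
    (1 - s * (π * b₁ + π * b₃ * l)) - s ^ 2 * A * (b₁ + b₃ * l) + s * b₃ * n * A := ⟨_, rfl⟩
  rw [← hU] at hz
  rw [← hA] at hz₃
  have key : A * U * (z - z₁ - z₂) = π * E := by
    rw [hE, hs]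
    linear_combination A * hz + (-1 + (z₁ + z₂) * (π * b₁ + π * b₃ * l)) * hz₃ -
      A * (z₁ + z₂) * hU
  have quot : l = A * (s ^ 2 - z₁ * z₂) + π * (b₁ * l + b₂ * n + b₃ * l ^ 2 + 2 * b₄ * l * n +
      3 * b₆ * l ^ 2 * n) * s + π * (b₁ + 2 * b₃ * l + b₄ * n + 3 * b₆ * l * n) * n := by
    rw [hs, hA]
    rw [hw₁, hw₂] at hl
    linear_combination hl
  -- The product of the three roots of the cubic; as `V` is a unit, `z₁ * z₂` divides `n`.
  have hn : V * n = z₁ * z₂ * (A * z₃) := by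
    rw [hA] at hz₃ ⊢
    rw [hw₁, hw₂] at hl
    rw [hw₁] at h₁
    rw [hV]
    linear_combination -z₁ * z₂ * hz₃ + h₁ - z₁ * hl
  obtain ⟨n', hn'⟩ : z₁ * z₂ ∣ n := uV.dvd_mul_left.1 (Dvd.intro _ hn.symm)
  -- Apart from multiples of `n`, `E` is `(b₁ + b₃ l) * (l - s² A - ...)`; inserting `quot` for `l`
  -- leaves only terms containing `z₁ * z₂` or `n`.
  have hdvd : z₁ * z₂ ∣ E := by
    refine ⟨?_, ?_⟩
    · exact (b₁ + b₃ * l) * (-A + π * (s * (b₂ + 2 * b₄ * l + 3 * b₆ * l ^ 2) +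
        (b₁ + 2 * b₃ * l + b₄ * n + 3 * b₆ * l * n)) * n') +
        (b₂ + 2 * b₄ * l + 3 * b₆ * l ^ 2) * (1 - s * (π * b₁ + π * b₃ * l)) * n' +
          s * b₃ * A * n'
    · rw [hE]
      linear_combination (b₁ + b₃ * l) * quot + ((b₁ + b₃ * l) * π *
        (s * (b₂ + 2 * b₄ * l + 3 * b₆ * l ^ 2) + (b₁ + 2 * b₃ * l + b₄ * n + 3 * b₆ * l * n)) +
        (b₂ + 2 * b₄ * l + 3 * b₆ * l ^ 2) * (1 - s * (π * b₁ + π * b₃ * l)) + s * b₃ * A) * hn'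
  obtain ⟨E', rfl⟩ := hdvd
  obtain ⟨h, hh⟩ : π * z₁ * z₂ ∣ z - z₁ - z₂ :=
    (uA.mul uU).dvd_mul_left.1 ⟨E', by rw [key]; ring⟩
  refine ⟨Dvd.intro _ hh.symm, ?_⟩
  have hAU : A * U * (z₁ * z₂ * h) = z₁ * z₂ * E' := by
    apply mul_left_cancel₀ hp0
    rw [← key, hh]; ring
  have hmod : π ∣ z₁ * z₂ * h - -(z₁ * z₂) * (b₁ + b₂ * (z₁ + z₂) +
      b₃ * (2 * z₁ ^ 2 + 3 * z₁ * z₂ + 2 * z₂ ^ 2) +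
      2 * b₄ * ((z₁ + z₂) * (z₁ ^ 2 + z₁ * z₂ + z₂ ^ 2)) +
      3 * b₆ * ((z₁ + z₂) * (z₁ ^ 2 + z₁ * z₂ + z₂ ^ 2) ^ 2)) := by
    -- Modulo `p` the curve is `w = z ^ 3`: `A` and `U` become `1`, `l` becomes `z₁² + z₁ z₂ + z₂²`
    -- and `n` becomes `-z₁ z₂ (z₁ + z₂)`.
    have hπ0 : PadicInt.toZMod π = 0 := by rw [← hπ]; simp
    have toZ {a b : ℤ_[p]} (hab : a = b) : PadicInt.toZMod a = PadicInt.toZMod b := congrArg _ hab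
    rw [← hπ, ← PadicInt.norm_lt_one_iff_dvd, ← PadicInt.padic_norm_e_of_padicInt,
      ← toZMod_eq_zero_iff]
    have m1 := toZ hAU
    have m2 := toZ hA
    have m3 := toZ hU
    have m4 := toZ hE
    have m5 := toZ hl
    have m6 := toZ h₁
    have m7 := toZ hw₁
    have m8 := toZ hs
    simp only [map_add, map_sub, map_mul, map_pow, map_neg, map_one, map_ofNat, hπ0, zero_mul,
      mul_zero, add_zero, sub_zero, mul_one] at m1 m2 m3 m4 m5 m6 m7 m8 ⊢
    have m9 : PadicInt.toZMod n = -(PadicInt.toZMod z₁ * PadicInt.toZMod z₂ *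
        (PadicInt.toZMod z₁ + PadicInt.toZMod z₂)) := by
      linear_combination m6 - m7 - PadicInt.toZMod z₁ * m5
    rw [m2, m3, one_mul, one_mul] at m1
    rw [m1, m4, m2, m8, m9, m5]
    ring
  obtain ⟨c, hc⟩ := hmod
  refine ⟨c, ?_⟩
  rw [hh]
  linear_combination π * hc

end Integral

/-! ### The points of nonsingular reduction correspond to `ℤ_p` -/

section PointParameter

variable {p : ℕ} [Fact p.Prime] {W : WeierstrassCurve ℤ_[p]}

@[norm_cast]
theorem padicInt_coe_inj {a b : ℤ_[p]} : (a : ℚ_[p]) = b ↔ a = b := ⟨PadicInt.ext, congrArg _⟩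

theorem chartEquation_coe_iff {z w : ℤ_[p]} :
    ChartEquation (genericFiber W) (z : ℚ_[p]) w ↔ ChartEquation W z w := by
  simp only [ChartEquation, WeierstrassCurve.map_a₁, WeierstrassCurve.map_a₂,
    WeierstrassCurve.map_a₃, WeierstrassCurve.map_a₄, WeierstrassCurve.map_a₆,
    PadicInt.algebraMap_apply]
  norm_cast

theorem HasChart.chartEquation {P : (genericFiber W).Point} {z w : ℤ_[p]}
    (h : HasChart (genericFiber W) P z w) : ChartEquation W z w :=
  chartEquation_coe_iff.1 h.equation

theorem HasChart.point_eq {P Q : (genericFiber W).Point} {z w : ℤ_[p]}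
    (hP : HasChart (genericFiber W) P z w) (hQ : HasChart (genericFiber W) Q z w) : P = Q := by
  rcases P with _ | ⟨x₁, y₁, h₁⟩ <;> rcases Q with _ | ⟨x₂, y₂, h₂⟩
  · rfl
  · have := hQ.2
    rw [hP.2, mul_zero] at this
    norm_num at this
  · have := hP.2
    rw [hQ.2, mul_zero] at this
    norm_num at this
  · have hw : (w : ℚ_[p]) ≠ 0 := by
      intro h
      have := hP.2
      rw [h, mul_zero] at this
      norm_num at this
    have hx : x₁ = x₂ := mul_right_cancel₀ hw (hP.1.trans hQ.1.symm)
    have hy : y₁ = y₂ := mul_right_cancel₀ hw (hP.2.trans hQ.2.symm)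
    subst hx hy
    rfl

/-- If `‖y‖ < ‖x‖`, then `x ^ 3` strictly dominates every other term of the equation. This makes `-x
/ y` integral. -/
theorem norm_x_le_norm_y (hW : CoeffsDivisible W) {x y : ℚ_[p]}
    (h : (genericFiber W).Nonsingular x y) (hx : 1 ≤ ‖x‖) : ‖x‖ ≤ ‖y‖ := by
  by_contra! hy
  have e : x ^ 3 = y ^ 2 + W.a₁ * x * y + W.a₃ * y - W.a₂ * x ^ 2 - W.a₄ * x - W.a₆ := by
    linear_combination -equation_coe h
  have h1 := norm_coe_lt hW.a₁
  have h2 := norm_coe_lt hW.a₂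
  have h3 := norm_coe_lt hW.a₃
  have h4 := norm_coe_lt hW.a₄
  have h6 := norm_coe_lt hW.a₆
  have hy0 := norm_nonneg y
  have p2 : ‖x‖ ≤ ‖x‖ ^ 2 := by nlinarith
  have p3 : ‖x‖ ^ 2 ≤ ‖x‖ ^ 3 := by nlinarith [sq_nonneg ‖x‖]
  have hxy : ‖x‖ * ‖y‖ < ‖x‖ ^ 2 := by nlinarith
  have : ‖x ^ 3‖ < ‖x‖ ^ 3 := by
    rw [e]
    refine norm_sub_lt (norm_sub_lt (norm_sub_lt (norm_add_lt (norm_add_lt ?_ ?_) ?_) ?_) ?_) ?_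
    all_goals try simp only [norm_mul, norm_pow]
    · nlinarith
    · rw [mul_assoc]
      refine lt_of_le_of_lt (mul_le_of_le_one_left (by positivity) h1.le) (hxy.trans_le p3)
    · refine lt_of_le_of_lt (mul_le_of_le_one_left hy0 h3.le) (hy.trans_le (p2.trans p3))
    · refine lt_of_lt_of_le (mul_lt_of_lt_one_left (by nlinarith) h2) p3
    · refine lt_of_lt_of_le (mul_lt_of_lt_one_left (by linarith) h4) (p2.trans p3)
    · exact h6.trans_le (hx.trans (p2.trans p3))
  rw [norm_pow] at this
  exact lt_irrefl _ this

/-- A point has nonsingular reduction exactly if its coordinates `z` and `w` exist and are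
integral. -/
theorem mem_E₀_iff (hW : CoeffsDivisible W) {P : (genericFiber W).Point} :
    P ∈ E₀ W hW ↔ ∃ z w : ℤ_[p], HasChart (genericFiber W) P z w := by
  change HasNonsingularReduction W P ↔ _
  rcases P with _ | ⟨x, y, h⟩
  · exact ⟨fun _ => ⟨0, 0, by simp [HasChart]⟩, fun _ => trivial⟩
  · rw [reduction_some_iff hW]
    constructor
    · intro hx
      have hxy := norm_x_le_norm_y hW h hx
      have hy : 1 ≤ ‖y‖ := hx.trans hxy
      have hy0 : y ≠ 0 := norm_pos_iff.1 (one_pos.trans_le hy)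
      refine ⟨⟨-x / y, ?_⟩, ⟨-1 / y, ?_⟩, ?_, ?_⟩
      · rw [norm_div, norm_neg]
        exact div_le_one_of_le₀ hxy (norm_nonneg _)
      · rw [norm_div, norm_neg, norm_one]
        exact div_le_one_of_le₀ hy (norm_nonneg _)
      · change x * (-1 / y) = -x / y
        ring
      · change y * (-1 / y) = -1
        field_simp
    · rintro ⟨z, w, hc⟩
      have hw : (w : ℚ_[p]) ≠ 0 := by
        intro h0
        have := hc.2
        rw [h0, mul_zero] at this
        norm_num at this
      obtain ⟨u, hu, e⟩ := hc.chartEquation.eq_mul_isUnit hW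
      have hwz : ‖w‖ ≤ ‖z‖ :=
        norm_le_of_dvd ((hu.dvd_mul_right.1 ⟨z ^ 2, by rw [e]; ring⟩))
      have hx := congrArg norm hc.1
      rw [norm_mul, PadicInt.padic_norm_e_of_padicInt, PadicInt.padic_norm_e_of_padicInt] at hx
      have hw0 : 0 < ‖w‖ := by rw [← PadicInt.padic_norm_e_of_padicInt]; exact norm_pos_iff.2 hw
      by_contra! hlt
      nlinarith

theorem exists_point_of_chartEquation [(genericFiber W).IsElliptic] (hW : CoeffsDivisible W)
    {z w : ℤ_[p]} (h : ChartEquation W z w) : ∃ P, HasChart (genericFiber W) P z w := by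
  rcases eq_or_ne w 0 with rfl | hw
  · rw [(h.eq_zero_iff hW).2 rfl]
    exact ⟨.zero, by simp [HasChart]⟩
  · have hw' : (w : ℚ_[p]) ≠ 0 := by exact_mod_cast hw
    have e := chartEquation_coe_iff.2 h
    rw [ChartEquation] at e
    have heq : (genericFiber W).Equation (z / w : ℚ_[p]) (-1 / w) := by
      rw [WeierstrassCurve.Affine.equation_iff]
      field_simp
      linear_combination e
    refine ⟨.some _ _ (WeierstrassCurve.Affine.equation_iff_nonsingular.1 heq), ?_, ?_⟩
    · exact div_mul_cancel₀ _ hw'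
    · exact div_mul_cancel₀ _ hw'

theorem exists_chart_add (hW : CoeffsDivisible W) {P₁ P₂ : (genericFiber W).Point}
    {z₁ w₁ z₂ w₂ : ℤ_[p]} (c₁ : HasChart (genericFiber W) P₁ z₁ w₁)
    (c₂ : HasChart (genericFiber W) P₂ z₂ w₂) :
    ∃ z w : ℤ_[p], HasChart (genericFiber W) (P₁ + P₂) z w ∧
      (p : ℤ_[p]) * z₁ * z₂ ∣ z - z₁ - z₂ ∧
      (p : ℤ_[p]) ^ 2 ∣ z - z₁ - z₂ - firstOrderCocycle W z₁ z₂ := by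
  have q₁ := c₁.chartEquation
  have q₂ := c₂.chartEquation
  rcases P₁ with _ | ⟨x₁, y₁, h₁⟩
  · have hz : z₁ = 0 := by exact_mod_cast c₁.1
    refine ⟨z₂, w₂, ?_, ?_, ?_⟩
    · change HasChart _ (0 + P₂) _ _
      rwa [zero_add]
    · simp [hz]
    · simp [hz, firstOrderCocycle]
  rcases P₂ with _ | ⟨x₂, y₂, h₂⟩
  · have hz : z₂ = 0 := by exact_mod_cast c₂.1
    refine ⟨z₁, w₁, ?_, ?_, ?_⟩
    · change HasChart _ (_ + 0) _ _
      rwa [add_zero]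
    · simp [hz]
    · simp [hz, firstOrderCocycle]
  have hz₁ : z₁ ≠ 0 := by
    intro h
    have := c₁.2
    rw [(q₁.eq_zero_iff hW).1 h] at this
    simp at this
  have hz₂ : z₂ ≠ 0 := by
    intro h
    have := c₂.2
    rw [(q₂.eq_zero_iff hW).1 h] at this
    simp at this
  obtain ⟨l, hl, hl'⟩ := exists_slope hW q₁ q₂
  obtain ⟨n, hn⟩ : ∃ n, n = w₁ - l * z₁ := ⟨_, rfl⟩
  have hw₁ : w₁ = l * z₁ + n := by linear_combination -hn
  have hw₂ : w₂ = l * z₂ + n := by linear_combination hl - hn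
  have uA : IsUnit (1 + W.a₂ * l + W.a₄ * l ^ 2 + W.a₆ * l ^ 3) := by
    rw [add_assoc, add_assoc]
    exact isUnit_one_add ((hW.a₂.mul_right _).add ((hW.a₄.mul_right _).add (hW.a₆.mul_right _)))
  obtain ⟨t, ht⟩ := uA.dvd (a := -(W.a₁ * l + W.a₂ * n + W.a₃ * l ^ 2 + 2 * W.a₄ * l * n +
    3 * W.a₆ * l ^ 2 * n))
  obtain ⟨z₃, hz₃⟩ : ∃ z₃, z₁ + z₂ + z₃ = t := ⟨t - z₁ - z₂, by ring⟩
  rw [← hz₃] at ht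
  have uU : IsUnit (1 - W.a₁ * z₃ - W.a₃ * (l * z₃ + n)) := by
    rw [show 1 - W.a₁ * z₃ - W.a₃ * (l * z₃ + n) =
      1 + (W.a₁ * -z₃ + W.a₃ * -(l * z₃ + n)) by ring]
    exact isUnit_one_add ((hW.a₁.mul_right _).add (hW.a₃.mul_right _))
  obtain ⟨z, hz⟩ := uU.dvd (a := -z₃)
  obtain ⟨w, hw⟩ := uU.dvd (a := -(l * z₃ + n))
  rw [mul_comm (1 - W.a₁ * z₃ - W.a₃ * (l * z₃ + n))] at hz hw
  refine ⟨z, w, ?_, third_point_congruences hW q₁ hw₁ hw₂ hl' ht.symm hz.symm⟩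
  have c₃ := c₁.neg_add (l := (l : ℚ_[p])) (n := n) (z₃ := z₃) c₂ (by exact_mod_cast hw₁)
    (by exact_mod_cast hw₂) (by exact_mod_cast hz₁) (by exact_mod_cast hz₂)
    (by simp only [WeierstrassCurve.map_a₁, WeierstrassCurve.map_a₂,
          WeierstrassCurve.map_a₃, WeierstrassCurve.map_a₄, WeierstrassCurve.map_a₆,
          PadicInt.algebraMap_apply]
        exact_mod_cast hl')
    (by simp only [WeierstrassCurve.map_a₂, WeierstrassCurve.map_a₄, WeierstrassCurve.map_a₆,
          PadicInt.algebraMap_apply]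
        exact_mod_cast uA.ne_zero)
    (by have h := congrArg (algebraMap ℤ_[p] ℚ_[p]) ht.symm
        simp only [map_add, map_mul, map_neg, map_pow, map_one, map_ofNat] at h
        exact h)
  have c₄ := c₃.neg (z' := (z : ℚ_[p])) (w' := w)
    (by simp only [WeierstrassCurve.map_a₁, WeierstrassCurve.map_a₃, PadicInt.algebraMap_apply]
        exact_mod_cast hz.symm)
    (by simp only [WeierstrassCurve.map_a₁, WeierstrassCurve.map_a₃, PadicInt.algebraMap_apply]
        exact_mod_cast hw.symm)
    (by simp only [WeierstrassCurve.map_a₁, WeierstrassCurve.map_a₃, PadicInt.algebraMap_apply]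
        exact_mod_cast uU.ne_zero)
  rwa [neg_neg] at c₄

/-- The coordinate `z = -x / y` on the points of nonsingular reduction. -/
theorem exists_parameter [(genericFiber W).IsElliptic] (hW : CoeffsDivisible W) :
    ∃ z : E₀ W hW ≃ ℤ_[p], IsParameter z ∧
      (∀ P : E₀ W hW, ∃ w : ℤ_[p], HasChart (genericFiber W) P (z P) w) ∧
      ∀ P Q, (p : ℤ_[p]) ^ 2 ∣ z (P + Q) - z P - z Q - firstOrderCocycle W (z P) (z Q) := by
  choose f g hfg using fun P : E₀ W hW => (mem_E₀_iff hW).1 P.2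
  have huniq {P : E₀ W hW} {z w : ℤ_[p]} (h : HasChart (genericFiber W) P z w) : f P = z := by
    have h' := hfg P
    rcases hP : (P : (genericFiber W).Point) with _ | ⟨x, y, hxy⟩
    · rw [hP] at h h'
      exact PadicInt.ext (h'.1.trans h.1.symm)
    · rw [hP] at h h'
      have hy : y ≠ 0 := by
        rintro rfl
        have := h.2
        rw [zero_mul] at this
        norm_num at this
      have hw : (g P : ℚ_[p]) = w := mul_left_cancel₀ hy (h'.2.trans h.2.symm)
      exact PadicInt.ext (by rw [← h'.1, ← h.1, hw])
  have hbij : Function.Bijective f := by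
    constructor
    · intro P Q hPQ
      have hQ := hfg Q
      rw [← hPQ, (hfg Q).chartEquation.unique hW (hPQ ▸ (hfg P).chartEquation)] at hQ
      exact Subtype.ext ((hfg P).point_eq hQ)
    · intro a
      obtain ⟨w, hw⟩ := exists_chartEquation hW a
      obtain ⟨P, hP⟩ := exists_point_of_chartEquation hW hw
      exact ⟨⟨P, (mem_E₀_iff hW).2 ⟨a, w, hP⟩⟩, huniq hP⟩
  have hadd (P Q : E₀ W hW) : (p : ℤ_[p]) * f P * f Q ∣ f (P + Q) - f P - f Q ∧
      (p : ℤ_[p]) ^ 2 ∣ f (P + Q) - f P - f Q - firstOrderCocycle W (f P) (f Q) := by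
    obtain ⟨z, w, h, hh⟩ := exists_chart_add hW (hfg P) (hfg Q)
    rwa [huniq (P := P + Q) h]
  refine ⟨Equiv.ofBijective f hbij, ⟨fun P Q => ?_⟩, fun P => ⟨g P, hfg P⟩, fun P Q => (hadd P Q).2⟩
  rw [← norm_mul, ← norm_mul]
  exact norm_le_of_dvd (hadd P Q).1

end PointParameter

/-! ### Comparison with the topology of the projective plane -/

section Topology

variable {p : ℕ} [Fact p.Prime] {W : WeierstrassCurve ℤ_[p]}

theorem toPlane_eq {K : Type*} [Field K] {E : WeierstrassCurve.Affine K} {P : E.Point} {z w : K}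
    (h : HasChart E P z w) :
    toPlane E P = Projectivization.mk K ![z, -1, w] (fun h => by simpa using congrFun h 1) := by
  rcases P with _ | ⟨x, y, hxy⟩
  · obtain ⟨rfl, rfl⟩ := h
    rw [toPlane, Projectivization.mk_eq_mk_iff']
    refine ⟨-1, ?_⟩
    ext i; fin_cases i <;> simp
  · obtain ⟨hx, hy⟩ := h
    rw [toPlane, Projectivization.mk_eq_mk_iff']
    refine ⟨-y, ?_⟩
    ext i
    fin_cases i
    · simp only [Fin.zero_eta, Pi.smul_apply, Matrix.cons_val_zero, smul_eq_mul]
      linear_combination y * hx - x * hy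
    · simp
    · simp only [Fin.reduceFinMk, Pi.smul_apply, Matrix.cons_val, smul_eq_mul]
      linear_combination -hy

/-- The ratio `-v 0 / v 1` is continuous where `v 1 ≠ 0` and invariant under scaling, so it descends
to the quotient topology; on points it is `z`. -/
theorem isOpen_ratio_preimage {K : Type*} [Field K] [TopologicalSpace K] [IsTopologicalRing K]
    [T1Space K] [ContinuousInv₀ K] {V : Set K} (hV : IsOpen V) :
    IsOpen {q : ℙ K (Fin 3 → K) | ∃ (v : Fin 3 → K) (hv : v ≠ 0), q = Projectivization.mk K v hv ∧
      v 1 ≠ 0 ∧ -v 0 / v 1 ∈ V} := by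
  refine isOpen_coinduced.2 ?_
  have h : IsOpen {v : {v : Fin 3 → K // v ≠ 0} | v.1 1 ≠ 0 ∧ -v.1 0 / v.1 1 ∈ V} := by
    have hv (i : Fin 3) : Continuous fun v : {v : Fin 3 → K // v ≠ 0} => v.1 i :=
      (continuous_apply i).comp continuous_subtype_val
    have h1 : ContinuousOn (fun v : {v : Fin 3 → K // v ≠ 0} => -v.1 0 / v.1 1)
        {v | v.1 1 ≠ 0} :=
      (hv 0).neg.continuousOn.div (hv 1).continuousOn fun v h => h
    exact h1.isOpen_inter_preimage (isOpen_ne_fun (hv 1) continuous_const) hV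
  convert h using 1
  ext ⟨v, hv⟩
  constructor
  · rintro ⟨u, hu, e, h1, h2⟩
    obtain ⟨a, rfl⟩ := (Projectivization.mk_eq_mk_iff' K v u hv hu).1 e
    have ha : a ≠ 0 := by rintro rfl; exact hv (zero_smul K u)
    refine ⟨mul_ne_zero ha h1, ?_⟩
    change -(a * u 0) / (a * u 1) ∈ V
    rwa [← mul_neg, mul_div_mul_left _ _ ha]
  · rintro ⟨h1, h2⟩
    exact ⟨v, hv, rfl, h1, h2⟩

/-- The inverse is `a ↦ (a : -1 : w)`, with `w` a 1-Lipschitz function of `a`; `z` itself is a ratio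
of homogeneous coordinates. -/
theorem isHomeomorph_parameter (hW : CoeffsDivisible W) (z : E₀ W hW ≃ ℤ_[p])
    (hz : ∀ P : E₀ W hW, ∃ w : ℤ_[p], HasChart (genericFiber W) P (z P) w) :
    IsHomeomorph z := by
  choose w hw using hz
  have hplane (P : E₀ W hW) := toPlane_eq (hw P)
  have hind : Topology.IsInducing fun P : E₀ W hW => toPlane (genericFiber W) P :=
    (Topology.IsInducing.induced (toPlane (genericFiber W))).comp .subtypeVal
  have hwc : Continuous fun a => w (z.symm a) := by
    refine (LipschitzWith.of_dist_le_mul (K := 1) fun a b => ?_).continuous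
    have h := (hw (z.symm b)).chartEquation.norm_sub_le hW (hw (z.symm a)).chartEquation
    rw [z.apply_symm_apply, z.apply_symm_apply] at h
    simpa [dist_eq_norm] using h
  have hsymm : Continuous z.symm := by
    rw [hind.continuous_iff]
    have h0 (a : ℤ_[p]) : ![(a : ℚ_[p]), -1, w (z.symm a)] ≠ 0 :=
      fun h => by simpa using congrFun h 1
    have hc : Continuous fun a : ℤ_[p] => Projectivization.mk' ℚ_[p]
        ⟨![(a : ℚ_[p]), -1, w (z.symm a)], h0 a⟩ := by
      refine continuous_coinduced_rng.comp (Continuous.subtype_mk ?_ _)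
      refine continuous_pi fun i => ?_
      fin_cases i
      · exact continuous_subtype_val
      · exact continuous_const
      · exact continuous_subtype_val.comp hwc
    refine hc.congr fun a => ?_
    rw [Function.comp_apply, hplane]
    simp only [z.apply_symm_apply]
    rfl
  have hcont : Continuous z := by
    have h : Continuous fun P => (z P : ℚ_[p]) := by
      refine continuous_def.2 fun V hV => ?_
      convert (isOpen_ratio_preimage hV).preimage hind.continuous using 1
      ext P
      constructor
      · intro hP
        refine ⟨_, _, hplane P, by simp, ?_⟩
        simpa using hP
      · rintro ⟨v, hv, e, h1, h2⟩
        replace e := (hplane P).symm.trans e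
        rw [Projectivization.mk_eq_mk_iff'] at e
        obtain ⟨a, ha⟩ := e
        have e0 : a * v 0 = z P := congrFun ha 0
        have e1 : a * v 1 = -1 := congrFun ha 1
        have e2 : -v 0 / v 1 = (z P : ℚ_[p]) := by
          rw [div_eq_iff h1]
          linear_combination v 1 * e0 - v 0 * e1
        rwa [e2] at h2
    exact h.subtype_mk _
  exact (Homeomorph.mk z hcont hsymm).isHomeomorph

end Topology

/-! ### The `p`-fold multiple modulo `p ^ 2` and the special cases -/

section Criterion

variable {p : ℕ} [Fact p.Prime] {W : WeierstrassCurve ℤ_[p]}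

/-- The cocycle is `p` times an integral polynomial, so knowing its argument modulo `p` suffices
modulo `p ^ 2`. -/
theorem dvd_firstOrderCocycle_sub (hW : CoeffsDivisible W) {X Y Z : ℤ_[p]}
    (h : (p : ℤ_[p]) ∣ X - Y) :
    (p : ℤ_[p]) ^ 2 ∣ firstOrderCocycle W X Z - firstOrderCocycle W Y Z := by
  obtain ⟨b₁, hb₁⟩ := hW.a₁
  obtain ⟨b₂, hb₂⟩ := hW.a₂
  obtain ⟨b₃, hb₃⟩ := hW.a₃
  obtain ⟨b₄, hb₄⟩ := hW.a₄
  obtain ⟨b₆, hb₆⟩ := hW.a₆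
  let f (T : ℤ_[p]) : ℤ_[p] := -(T * Z) * (b₁ + b₂ * (T + Z) +
    b₃ * (2 * T ^ 2 + 3 * T * Z + 2 * Z ^ 2) + 2 * b₄ * ((T + Z) * (T ^ 2 + T * Z + Z ^ 2)) +
    3 * b₆ * ((T + Z) * (T ^ 2 + T * Z + Z ^ 2) ^ 2))
  have hf (T : ℤ_[p]) : firstOrderCocycle W T Z = p * f T := by
    rw [firstOrderCocycle, hb₁, hb₂, hb₃, hb₄, hb₆]
    ring
  rw [hf, hf, ← mul_sub, pow_two]
  refine mul_dvd_mul_left _ ?_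
  rw [← PadicInt.norm_lt_one_iff_dvd, ← PadicInt.padic_norm_e_of_padicInt,
    ← toZMod_eq_zero_iff] at h ⊢
  rw [map_sub, sub_eq_zero] at h ⊢
  simp only [f, map_add, map_mul, map_neg, map_pow, h]

/-- Sums of the first-order cocycle. -/
theorem exists_sum_firstOrderCocycle {R : Type*} [CommRing R] (W : WeierstrassCurve R) (k : ℕ) :
    ∃ s₁ s₂ s₃ s₄ s₆ : ℕ, 2 * s₁ + k = k ^ 2 ∧ 3 * s₂ + k = k ^ 3 ∧ 2 * s₃ + k = k ^ 4 ∧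
      5 * s₄ + k = k ^ 5 ∧ 7 * s₆ + k = k ^ 7 ∧
      ∑ j ∈ Finset.range k, firstOrderCocycle W (j : R) 1 =
        -(W.a₁ * s₁ + W.a₂ * s₂ + W.a₃ * s₃ + 2 * W.a₄ * s₄ + 3 * W.a₆ * s₆) := by
  induction k with
  | zero => exact ⟨0, 0, 0, 0, 0, by simp⟩
  | succ k ih =>
    obtain ⟨s₁, s₂, s₃, s₄, s₆, h₁, h₂, h₃, h₄, h₆, hs⟩ := ih
    -- The increments are `((k + 1) ^ n - k ^ n - 1) / d`, the coefficients of the cocycle at `(k,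
    -- 1)`.
    refine ⟨s₁ + k, s₂ + k * (k + 1), s₃ + k * (2 * k ^ 2 + 3 * k + 2),
      s₄ + k * ((k + 1) * (k ^ 2 + k + 1)), s₆ + k * ((k + 1) * (k ^ 2 + k + 1) ^ 2),
      ?_, ?_, ?_, ?_, ?_, ?_⟩
    · linear_combination h₁
    · linear_combination h₂
    · linear_combination h₃
    · linear_combination h₄
    · linear_combination h₆
    · rw [Finset.sum_range_succ, hs, firstOrderCocycle]
      push_cast
      ring

theorem dvd_of_mul_add_self_eq_pow {c s n : ℕ} (hc : ¬ p ∣ c) (hn : n ≠ 0)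
    (h : c * s + p = p ^ n) : p ∣ s := by
  have h1 : p ∣ c * s := (Nat.dvd_add_left dvd_rfl).1 (h ▸ dvd_pow_self p hn)
  exact ((Fact.out : p.Prime).dvd_mul.1 h1).resolve_left hc

/-- Multiples of a point with parameter `1`, modulo `p ^ 2`. -/
theorem dvd_param_nsmul_sub {G : Type*} [AddCommGroup G] {z : G ≃ ℤ_[p]} (hz : IsParameter z)
    (hW : CoeffsDivisible W)
    (hadd : ∀ P Q, (p : ℤ_[p]) ^ 2 ∣ z (P + Q) - z P - z Q - firstOrderCocycle W (z P) (z Q))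
    {P : G} (hP : z P = 1) (k : ℕ) :
    (p : ℤ_[p]) ^ 2 ∣ z (k • P) - k - ∑ j ∈ Finset.range k, firstOrderCocycle W (j : ℤ_[p]) 1 := by
  induction k with
  | zero => simp [hz.map_zero]
  | succ k ih =>
    have h1 : (p : ℤ_[p]) ∣ z (k • P) - k := by
      have h := hz.norm_nsmul_sub_le k P
      rw [hP, norm_one, mul_one, mul_one, mul_one] at h
      exact dvd_of_norm_le h
    have h2 := dvd_firstOrderCocycle_sub hW (Z := 1) h1
    have h3 := hadd (k • P) P
    rw [hP] at h3
    rw [succ_nsmul, Finset.sum_range_succ, Nat.cast_succ]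
    convert (h3.add ih).add h2 using 1
    ring

/-- Each `aᵢ` is divisible by `p`, so `(p ^ n - p) / d` matters only modulo `p`. It vanishes there
unless `p = d`; for `n = p = d` it is `p ^ (p - 1) - 1 ≡ -1`. For `p = 2` both `a₁` and `a₃`
survive. -/
theorem dvd_add_sum_iff_isSpecial (hW : CoeffsDivisible W) :
    (p : ℤ_[p]) ^ 2 ∣ p + ∑ j ∈ Finset.range p, firstOrderCocycle W (j : ℤ_[p]) 1 ↔
      IsSpecial W := by
  obtain ⟨s₁, s₂, s₃, s₄, s₆, h₁, h₂, h₃, h₄, h₆, hs⟩ := exists_sum_firstOrderCocycle W p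
  rw [hs, IsSpecial]
  obtain ⟨b₁, hb₁⟩ := hW.a₁
  obtain ⟨b₂, hb₂⟩ := hW.a₂
  obtain ⟨b₃, hb₃⟩ := hW.a₃
  obtain ⟨b₄, hb₄⟩ := hW.a₄
  obtain ⟨b₆, hb₆⟩ := hW.a₆
  have hp : p.Prime := Fact.out
  by_cases h2 : p = 2
  · subst h2
    obtain rfl : s₁ = 1 := by omega
    obtain rfl : s₂ = 2 := by omega
    obtain rfl : s₃ = 7 := by omega
    obtain rfl : s₄ = 6 := by omega
    obtain rfl : s₆ = 18 := by omega
    norm_num at hb₁ hb₂ hb₃ hb₄ hb₆ ⊢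
    constructor
    · rintro ⟨c, hc⟩
      exact ⟨-c - b₂ - 3 * b₃ - 6 * b₄ - 27 * b₆, by
        linear_combination -hc - 2 * hb₂ - 6 * hb₃ - 12 * hb₄ - 54 * hb₆⟩
    · rintro ⟨c, hc⟩
      exact ⟨-c - b₂ - 3 * b₃ - 6 * b₄ - 27 * b₆, by
        linear_combination -hc - 2 * hb₂ - 6 * hb₃ - 12 * hb₄ - 54 * hb₆⟩
  by_cases h3 : p = 3
  · subst h3
    obtain rfl : s₁ = 3 := by omega
    obtain rfl : s₂ = 8 := by omega
    obtain rfl : s₃ = 39 := by omega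
    obtain rfl : s₄ = 48 := by omega
    obtain rfl : s₆ = 312 := by omega
    norm_num at hb₁ hb₂ hb₃ hb₄ hb₆ ⊢
    constructor
    · rintro ⟨c, hc⟩
      exact ⟨c + b₁ + 3 * b₂ + 13 * b₃ + 32 * b₄ + 312 * b₆ - 1, by
        linear_combination hc + 3 * hb₁ + 9 * hb₂ + 39 * hb₃ + 96 * hb₄ + 936 * hb₆⟩
    · rintro ⟨c, hc⟩
      exact ⟨c - b₁ - 3 * b₂ - 13 * b₃ - 32 * b₄ - 312 * b₆ + 1, by
        linear_combination hc - 3 * hb₁ - 9 * hb₂ - 39 * hb₃ - 96 * hb₄ - 936 * hb₆⟩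
  by_cases h5 : p = 5
  · subst h5
    obtain rfl : s₁ = 10 := by omega
    obtain rfl : s₂ = 40 := by omega
    obtain rfl : s₃ = 310 := by omega
    obtain rfl : s₄ = 624 := by omega
    obtain rfl : s₆ = 11160 := by omega
    norm_num at hb₁ hb₂ hb₃ hb₄ hb₆ ⊢
    constructor
    · rintro ⟨c, hc⟩
      -- The condition is `5 + 2 * a₄ ≡ 0` modulo `25`, and `13` inverts `2`.
      exact ⟨13 * c + 26 * b₁ + 104 * b₂ + 806 * b₃ + 649 * W.a₄ + 87048 * b₆ - 3, by
        linear_combination 13 * hc + 130 * hb₁ + 520 * hb₂ + 4030 * hb₃ + 435240 * hb₆⟩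
    · rintro ⟨c, hc⟩
      exact ⟨-1248 * c - 2 * b₁ - 8 * b₂ - 62 * b₃ - 6696 * b₆ - 499, by
        linear_combination -1248 * hc - 10 * hb₁ - 40 * hb₂ - 310 * hb₃ - 33480 * hb₆⟩
  by_cases h7 : p = 7
  · subst h7
    obtain rfl : s₁ = 21 := by omega
    obtain rfl : s₂ = 112 := by omega
    obtain rfl : s₃ = 1197 := by omega
    obtain rfl : s₄ = 3360 := by omega
    obtain rfl : s₆ = 117648 := by omega
    norm_num at hb₁ hb₂ hb₃ hb₄ hb₆ ⊢
    constructor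
    · rintro ⟨c, hc⟩
      -- The condition is `7 + 3 * a₆ ≡ 0` modulo `49`, and `33` inverts `3`.
      exact ⟨33 * c + 99 * b₁ + 528 * b₂ + 5643 * b₃ + 31680 * b₄ + 237697 * W.a₆ - 5, by
        linear_combination 33 * hc + 693 * hb₁ + 3696 * hb₂ + 39501 * hb₃ + 221760 * hb₄⟩
    · rintro ⟨c, hc⟩
      exact ⟨-352944 * c - 3 * b₁ - 16 * b₂ - 171 * b₃ - 960 * b₄ - 100841, by
        linear_combination -352944 * hc - 21 * hb₁ - 112 * hb₂ - 1197 * hb₃ - 6720 * hb₄⟩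
  have n2 : ¬ p ∣ 2 := fun h => h2 ((Nat.prime_dvd_prime_iff_eq hp Nat.prime_two).1 h)
  have n3 : ¬ p ∣ 3 := fun h => h3 ((Nat.prime_dvd_prime_iff_eq hp Nat.prime_three).1 h)
  have n5 : ¬ p ∣ 5 := fun h => h5 ((Nat.prime_dvd_prime_iff_eq hp Nat.prime_five).1 h)
  have n7 : ¬ p ∣ 7 := fun h => h7 ((Nat.prime_dvd_prime_iff_eq hp (by norm_num)).1 h)
  obtain ⟨t₁, rfl⟩ := dvd_of_mul_add_self_eq_pow n2 two_ne_zero h₁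
  obtain ⟨t₂, rfl⟩ := dvd_of_mul_add_self_eq_pow n3 three_ne_zero h₂
  obtain ⟨t₃, rfl⟩ := dvd_of_mul_add_self_eq_pow n2 four_ne_zero h₃
  obtain ⟨t₄, rfl⟩ := dvd_of_mul_add_self_eq_pow n5 (by norm_num) h₄
  obtain ⟨t₆, rfl⟩ := dvd_of_mul_add_self_eq_pow n7 (by norm_num) h₆
  simp only [h2, h3, h5, h7, false_and, or_false, iff_false]
  rintro ⟨c, hc⟩
  push_cast at hc
  rw [hb₁, hb₂, hb₃, hb₄, hb₆] at hc
  have hp0 : (p : ℤ_[p]) ≠ 0 := norm_pos_iff.1 norm_p_pos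
  have h1 : (p : ℤ_[p]) ∣ 1 := by
    refine ⟨c + (b₁ * t₁ + b₂ * t₂ + b₃ * t₃ + 2 * b₄ * t₄ + 3 * b₆ * t₆), ?_⟩
    apply mul_left_cancel₀ hp0
    linear_combination hc
  rw [← PadicInt.norm_lt_one_iff_dvd, norm_one] at h1
  exact lt_irrefl _ h1

end Criterion

end AdditiveReduction

theorem corollary1p2 (p : ℕ) [Fact p.Prime] (W : WeierstrassCurve ℤ_[p])
    [(AdditiveReduction.genericFiber W).IsElliptic]
    (hW : AdditiveReduction.CoeffsDivisible W) :
    (∃! M : Module ℤ_[p] (AdditiveReduction.E₀ W hW),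
      letI := M
      ContinuousSMul ℤ_[p] (AdditiveReduction.E₀ W hW)) ∧
    ∀ [Module ℤ_[p] (AdditiveReduction.E₀ W hW)]
      [ContinuousSMul ℤ_[p] (AdditiveReduction.E₀ W hW)],
      (¬ AdditiveReduction.IsSpecial W →
        Nonempty (AdditiveReduction.E₀ W hW ≃ₗ[ℤ_[p]] ℤ_[p])) ∧
      (AdditiveReduction.IsSpecial W →
        Nonempty (AdditiveReduction.E₀ W hW ≃ₗ[ℤ_[p]] (ℤ_[p] × ZMod p))) := by
  open AdditiveReduction in
  obtain ⟨z, hz, hchart, hadd⟩ := exists_parameter hW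
  have hh := isHomeomorph_parameter hW z hchart
  have : T2Space (E₀ W hW) := (hh.homeomorph z).symm.t2Space
  obtain ⟨P, hP⟩ := z.surjective 1
  have hP1 : ‖z P‖ = 1 := by rw [hP, norm_one]
  have hpP := dvd_param_nsmul_sub hz hW hadd hP p
  obtain ⟨c, hc⟩ : (p : ℤ_[p]) ∣ z (p • P) := by
    have h := hz.norm_nsmul_sub_le p P
    rw [hP, norm_one, mul_one, mul_one, mul_one] at h
    exact (dvd_sub_left dvd_rfl).1 (dvd_of_norm_le h)
  -- `z (p • P)` is congruent to `p` plus the cocycle sum modulo `p ^ 2`, and being smaller than `p`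
  -- in norm means divisibility by `p ^ 2`.
  have hlt : ‖z (p • P)‖ < ‖(p : ℤ_[p])‖ ↔ IsSpecial W := by
    rw [← dvd_add_sum_iff_isSpecial hW, ← dvd_iff_dvd_of_dvd_sub (by rwa [sub_sub] at hpP), hc, norm_mul,
      mul_lt_iff_lt_one_right norm_p_pos, PadicInt.norm_lt_one_iff_dvd, pow_two]
    exact (mul_dvd_mul_iff_left (norm_pos_iff.1 norm_p_pos)).symm
  by_cases hs : IsSpecial W
  · obtain ⟨T, hT, hpT⟩ := hz.exists_torsion hh hP1 (hlt.2 hs)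
    obtain ⟨e, he⟩ := hz.exists_addEquiv_prod hh hT hpT
    obtain ⟨h1, h2⟩ := existsUnique_module_of_addEquiv (p := p) e he
    exact ⟨h1, by intro _ _; exact ⟨fun h => absurd hs h, fun _ => h2⟩⟩
  · have hgen : IsParameter.IsGenerator z P := by
      refine ⟨hP1, le_antisymm ?_ (not_lt.1 fun h => hs (hlt.1 h))⟩
      exact norm_le_of_dvd ⟨c, hc⟩
    obtain ⟨e, he, -⟩ := hz.exists_addEquiv hh hgen
    obtain ⟨h1, h2⟩ := existsUnique_module_of_addEquiv (p := p) e he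
    exact ⟨h1, by intro _ _; exact ⟨fun _ => h2, fun h => absurd h hs⟩⟩
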